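/- Let $f:\mathbb{R}^n\to\mathbb{R}$ be differentiable with $1$-Lipschitz gradient, let $g_1,\dots,g_m:\mathbb{R}^n\to\mathbb{R}$ be differentiable and concave (so that $C=\{x: g_i(x)\ge 0\ \forall i\}$ is convex), and suppose that Slater's condition holds: there is $z$ with $g_i(z)>0$ for all $i$. Let the functions $\alpha,\delta,\beta,\rho$ of time $t\ge 0$ be given by one of the following three choices: 1. (heavy ball) $\alpha=\delta=\sqrt\mu$, $\beta=0$, $\rho(t)=e^{-\sqrt\mu\,t}$, where $f$ is $\mu$-strongly convex, $\mu>0$; 2. (Nesterov, constant parameters) $\alpha=\sqrt\mu-\mu/2$, $\delta=\frac{\sqrt\mu}{1+\sqrt\mu}$, $\beta=\frac{1-\sqrt\mu}{1+\sqrt\mu}$, $\rho(t)=e^{-(\sqrt\mu-\mu/2)t}$, where $f$ is $\mu$-strongly convex, $\mu>0$; 3. (Nesterov, time-varying parameters) $\alpha(t)=\frac{2}{t+3}$, $\delta(t)=\frac{3}{2(t+3)}$, $\beta(t)=\frac{t}{t+3}$, $\rho(t)=\frac{9}{(t+3)^2}$, where $f$ is convex. Let $\epsilon\in[0,1)$.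 Let $u:[0,\infty)\to\mathbb{R}^n$ be of locally bounded variation with $u(0)=0$, and let $x(t)=x(0)+\int_0^t u(s)\,ds$ with $x(0)\in\mathbb{R}^n$ arbitrary (possibly infeasible). Write $u^\pm$ for the right and left limits of $u$, with $u(0)^-:=u(0)$ (a jump at time $0$ is allowed). Suppose that $(x,u)$ satisfies the measure-differential inclusion $$du+2\delta u\,dt+\nabla f(x+\beta u)\,dt=\sum_{i\in I_x}\nabla g_i(x)\,d\lambda_i,\qquad \gamma_i^++\epsilon\gamma_i^-\in N_{\mathbb{R}_{\le 0}}(-d\lambda_i)\quad (i\in I_x),$$ where $I_x=\{i: g_i(x)\le 0\}$, $\gamma_i^\pm=\nabla g_i(x)^{T}u^\pm+\alpha g_i(x)$, and $N_{\mathbb{R}_{\le0}}$ is the normal cone of $\mathbb{R}_{\le 0}$. Here $d\lambda_i=\ell_i\,(dt+d\eta)$ with $\ell_i$ locally integrable and $\eta$ the counting measure on the jump times of $u$; the equality is understood after integration over every compact interval $[t_0,t_1]\subset[0,\infty)$ (with $\int_{[t_0,t_1]}du=u(t_1)^+-u(t_0)^-$), and the inclusion is understood for the densities $\ell_i(t)$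 at $(dt+d\eta)$-almost every $t$. Let $x^*$ be a minimizer of $f$ over $C$. Then there is a multiplier $\lambda^*\in\mathbb{R}^m$ satisfying the Karush–Kuhn–Tucker conditions $\lambda^*\ge 0$, $\lambda_i^*g_i(x^*)=0$, $\nabla f(x^*)=\sum_i\lambda_i^*\nabla g_i(x^*)$, and for every such $\lambda^*$ and every $t\ge 0$ $$\min\{0,g(x(0))\}^{T}\lambda^*\,\rho(t)\ \le\ f(x(t))-f(x^*)\ \le\ \Big(\tfrac{\alpha(0)^2}{2}|x(0)-x^*|^2+f(x(0))-f(x^*)\Big)\rho(t),$$ where the minimum is taken componentwise. -/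

import Mathlib

open MeasureTheory Set

/-- Euclidean space `ℝⁿ` with the `ℓ²` norm. -/
abbrev Eucl (n : ℕ) : Type := EuclideanSpace ℝ (Fin n)

/-- `f` is `1`-smooth: differentiable, and its gradient has Lipschitz constant `1`. -/
def OneSmooth {n : ℕ} (f : Eucl n → ℝ) : Prop :=
  Differentiable ℝ f ∧ LipschitzWith 1 (gradient f)

/-- The feasible set `C = {x | g(x) ≥ 0}`. -/
def feasibleSet {n m : ℕ} (g : Fin m → Eucl n → ℝ) : Set (Eucl n) :=
  {x | ∀ i, 0 ≤ g i x}

/-- `xs` is a minimizer of `f` over the feasible set. -/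
def IsConstrainedMinimizer {n m : ℕ} (f : Eucl n → ℝ) (g : Fin m → Eucl n → ℝ)
    (xs : Eucl n) : Prop :=
  xs ∈ feasibleSet g ∧ IsMinOn f (feasibleSet g) xs

/-- Slater's condition: some point satisfies every constraint strictly. -/
def SlaterCondition {n m : ℕ} (g : Fin m → Eucl n → ℝ) : Prop :=
  ∃ z, ∀ i, 0 < g i z

/-- `xs` and the multiplier `lam` satisfy the Karush-Kuhn-Tucker conditions. -/
structure SatisfiesKKT {n m : ℕ} (f : Eucl n → ℝ) (g : Fin m → Eucl n → ℝ)
    (xs : Eucl n) (lam : Fin m → ℝ) : Prop where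
  feasible : xs ∈ feasibleSet g
  nonneg : ∀ i, 0 ≤ lam i
  complementary : ∀ i, lam i * g i xs = 0
  stationary : gradient f xs = ∑ i, lam i • gradient (g i) xs

/-- The normal cone of convex analysis of a set `S ⊆ ℝ` at `y`; it is empty if `y ∉ S`. -/
def normalConeReal (S : Set ℝ) (y : ℝ) : Set ℝ :=
  {w | y ∈ S ∧ ∀ z ∈ S, w * (z - y) ≤ 0}

/-- The left limit `u(t)⁻` of a function on `[0, ∞)`. At the initial time it is the
initial value `u(0)`, so that `u` may jump at time `0`. -/
noncomputable def limMinus {n : ℕ} (u : ℝ → Eucl n) (t : ℝ) : Eucl n :=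
  if t ≤ 0 then u 0 else Function.leftLim u t

/-- The right limit `u(t)⁺`. -/
noncomputable def limPlus {n : ℕ} (u : ℝ → Eucl n) (t : ℝ) : Eucl n :=
  Function.rightLim u t

/-- The times in `[0, ∞)` at which `u` jumps. -/
def jumpTimes {n : ℕ} (u : ℝ → Eucl n) : Set ℝ :=
  {t | 0 ≤ t ∧ limMinus u t ≠ limPlus u t}

/-- The measure `dt + dη` on `[0, ∞)`: Lebesgue measure plus a unit atom at each jump
time of `u`. -/
noncomputable def timeMeasure {n : ℕ} (u : ℝ → Eucl n) : Measure ℝ :=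
  volume.restrict (Ici 0) + Measure.count.restrict (jumpTimes u)

/-- The constraint velocity `γᵢ = ∇gᵢ(x)ᵀ v + a gᵢ(x)`, for one constraint function `h = gᵢ`. -/
noncomputable def constraintVelocity {n : ℕ} (h : Eucl n → ℝ) (a : ℝ) (x v : Eucl n) : ℝ :=
  inner ℝ (gradient h x) v + a * h x

open scoped Classical in
/-- The density `∑_{i ∈ I_x} ℓᵢ ∇gᵢ(x)` of the constraint force, `I_x = {i | gᵢ(x) ≤ 0}`. -/
noncomputable def constraintForce {n m : ℕ} (g : Fin m → Eucl n → ℝ) (x : Eucl n)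
    (l : Fin m → ℝ) : Eucl n :=
  ∑ i with g i x ≤ 0, l i • gradient (g i) x

/-- `(x, u)` is a trajectory on `[0, ∞)` of the measure-differential inclusion
`du + 2δu dt + ∇f(x + βu) dt = ∑_{i ∈ I_x} ∇gᵢ(x) dλᵢ`,
`γᵢ⁺ + ε γᵢ⁻ ∈ N_{ℝ≤0}(-dλᵢ)` for `i ∈ I_x`, with `dx = u dt`.

The velocity `u` has locally bounded variation. The multipliers are the measures
`dλᵢ = ℓᵢ (dt + dη)`, so neither they nor `du` have a singular continuous part. The equality of
measures is integrated over compact intervals, and the inclusion holds for the densities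
`ℓᵢ` at almost every `t` with respect to `dt + dη`; in particular, at every jump time. -/
def IsMDITrajectory {n m : ℕ} (f : Eucl n → ℝ) (g : Fin m → Eucl n → ℝ)
    (α δ β : ℝ → ℝ) (ε : ℝ) (x u : ℝ → Eucl n) : Prop :=
  LocallyBoundedVariationOn u (Ici 0) ∧
  (∀ t, 0 ≤ t → x t = x 0 + ∫ s in (0 : ℝ)..t, u s) ∧
  ∃ l : Fin m → ℝ → ℝ,
    (∀ i T, IntegrableOn (l i) (Icc 0 T) (timeMeasure u)) ∧
    (∀ t₀ t₁, 0 ≤ t₀ → t₀ ≤ t₁ →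
      limPlus u t₁ - limMinus u t₀
        + ∫ s in Icc t₀ t₁, ((2 * δ s) • u s + gradient f (x s + β s • u s))
      = ∫ s in Icc t₀ t₁, constraintForce g (x s) (fun i => l i s) ∂(timeMeasure u)) ∧
    (∀ᵐ t ∂(timeMeasure u), ∀ i, g i (x t) ≤ 0 →
      constraintVelocity (g i) (α t) (x t) (limPlus u t)
          + ε * constraintVelocity (g i) (α t) (x t) (limMinus u t)
        ∈ normalConeReal (Iic 0) (-(l i t)))

/-- The three choices of parameters. -/
inductive MomentumVariant where
  | heavyBall
  | nesterovConstant
  | nesterovVarying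

namespace MomentumVariant

/-- The parameter `α`. -/
noncomputable def alpha (μ : ℝ) : MomentumVariant → ℝ → ℝ
  | heavyBall, _ => √μ
  | nesterovConstant, _ => √μ - μ / 2
  | nesterovVarying, t => 2 / (t + 3)

/-- The damping parameter `δ`. -/
noncomputable def delta (μ : ℝ) : MomentumVariant → ℝ → ℝ
  | heavyBall, _ => √μ
  | nesterovConstant, _ => √μ / (1 + √μ)
  | nesterovVarying, t => 3 / (2 * (t + 3))

/-- The damping parameter `β`. -/
noncomputable def beta (μ : ℝ) : MomentumVariant → ℝ → ℝ
  | heavyBall, _ => 0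
  | nesterovConstant, _ => (1 - √μ) / (1 + √μ)
  | nesterovVarying, t => t / (t + 3)

/-- The rate `ρ`. -/
noncomputable def rho (μ : ℝ) : MomentumVariant → ℝ → ℝ
  | heavyBall, t => Real.exp (-(√μ * t))
  | nesterovConstant, t => Real.exp (-((√μ - μ / 2) * t))
  | nesterovVarying, t => 9 / (t + 3) ^ 2

/-- The convexity that is required of the objective: the two variants whose parameters
involve `μ` need strong convexity with constant `μ > 0`, the third one needs convexity
(which strong convexity implies) and ignores `μ`. -/
def Convexity {n : ℕ} (μ : ℝ) (f : Eucl n → ℝ) : MomentumVariant → Prop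
  | heavyBall => 0 < μ ∧ StrongConvexOn univ μ f
  | nesterovConstant => 0 < μ ∧ StrongConvexOn univ μ f
  | nesterovVarying => ConvexOn ℝ univ f

end MomentumVariant

/-! The upper bound is a Lyapunov argument: `ρ⁻¹ (½|α(x - xs) + u⁺|² + f(x) - f(xs))` never
increases. Away from jumps, its derivative has a contribution of the unconstrained dynamics,
nonpositive by `StrongConvexOn.energy_decay`, and a contribution of the contact force, nonpositive
by `inner_constraintForce_nonpos`. At a jump the position is continuous and the velocity changes by
the contact impulse `F`, so the energy changes by a positive multiple of `⟨F, 2α(x - xs) + u⁺ +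
u⁻⟩`, which the same contact lemma controls.

Since `u` only has bounded variation, this is carried out with measures: each ingredient of the
energy is a distribution function with a density with respect to `dt + dη`, and the product rule
`HasDensityOn.bilin` gives the density of the energy, atoms included. Its sign is then checked
almost everywhere in time and at every jump.

The lower bound combines weak duality, `f(x) - f(xs) ≥ ∑ λᵢ gᵢ(x)`, with the decay of each
violation. While `gᵢ(x) ≤ 0`, the complementarity condition makes the constraint velocity
nonnegative almost everywhere, so `gᵢ(x)/ρ` cannot decrease. Multipliers exist by separating convex
sets under Slater's condition. -/

/-! ### First-order inequalities for convex and concave functions. -/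

/-- Divide the strong convexity inequality on the segment from `x` to `y` by the parameter `t` and
let `t` decrease to `0`. -/
theorem StrongConvexOn.add_inner_gradient_add_le {E : Type*} [NormedAddCommGroup E]
    [InnerProductSpace ℝ E] [CompleteSpace E] {f : E → ℝ} {μ : ℝ} (hf : StrongConvexOn univ μ f)
    {x : E} (hd : DifferentiableAt ℝ f x) (y : E) :
    f x + inner ℝ (gradient f x) (y - x) + μ / 2 * ‖y - x‖ ^ 2 ≤ f y := by
  have hline : HasDerivAt (fun t : ℝ => f (x + t • (y - x))) (inner ℝ (gradient f x) (y - x)) 0 := by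
    have h1 : HasDerivAt (fun t : ℝ => x + t • (y - x)) (y - x) 0 := by
      simpa using ((hasDerivAt_id (0 : ℝ)).smul_const (y - x)).const_add x
    have h2 : HasFDerivAt f (fderiv ℝ f x) (x + (0 : ℝ) • (y - x)) := by
      simpa using hd.hasFDerivAt
    have h3 := h2.comp_hasDerivAt (0 : ℝ) h1
    rwa [← inner_gradient_left (𝕜 := ℝ)] at h3
  have hslope := hline.tendsto_slope_zero_right
  have hbound : ∀ᶠ t : ℝ in nhdsWithin 0 (Ioi 0),
      t⁻¹ • (f (x + (0 + t) • (y - x)) - f (x + (0 : ℝ) • (y - x))) ≤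
        f y - f x - (1 - t) * (μ / 2 * ‖y - x‖ ^ 2) := by
    filter_upwards [Ioo_mem_nhdsGT (zero_lt_one' ℝ)] with t ht
    have h := hf.2 (mem_univ x) (mem_univ y) (sub_nonneg.2 ht.2.le) ht.1.le (by ring)
    have e : (1 - t) • x + t • y = x + t • (y - x) := by module
    rw [e, norm_sub_rev] at h
    simp only [smul_eq_mul, zero_add, zero_smul, add_zero] at h ⊢
    rw [inv_mul_le_iff₀ ht.1]
    linarith
  have hlim : Filter.Tendsto (fun t : ℝ => f y - f x - (1 - t) * (μ / 2 * ‖y - x‖ ^ 2))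
      (nhdsWithin 0 (Ioi 0)) (nhds (f y - f x - (1 - 0) * (μ / 2 * ‖y - x‖ ^ 2))) := by
    apply Filter.Tendsto.mono_left _ nhdsWithin_le_nhds
    apply Continuous.tendsto
    fun_prop
  have := le_of_tendsto_of_tendsto hslope hlim hbound
  linarith

theorem ConcaveOn.le_add_inner_gradient {E : Type*} [NormedAddCommGroup E]
    [InnerProductSpace ℝ E] [CompleteSpace E] {g : E → ℝ} (hg : ConcaveOn ℝ univ g)
    {x : E} (hd : DifferentiableAt ℝ g x) (y : E) :
    g y ≤ g x + inner ℝ (gradient g x) (y - x) := by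
  have h := (strongConvexOn_zero.2 hg.neg).add_inner_gradient_add_le hd.neg y
  have e : inner ℝ (gradient (-g) x) (y - x) = - inner ℝ (gradient g x) (y - x) := by
    rw [inner_gradient_left, inner_gradient_left, fderiv_neg]; rfl
  rw [e] at h
  simp only [Pi.neg_apply] at h
  linarith

/-- The gradient of a concave function is bounded on bounded sets. -/
theorem ConcaveOn.exists_norm_gradient_le {n : ℕ} {g : Eucl n → ℝ} (hg : ConcaveOn ℝ univ g)
    (hd : Differentiable ℝ g) (R : ℝ) :
    ∃ C, ∀ z, ‖z‖ ≤ R → ‖gradient g z‖ ≤ C := by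
  obtain ⟨M, hM⟩ := (isCompact_closedBall (0 : Eucl n) (R + 1)).exists_bound_of_continuousOn
    hd.continuous.continuousOn
  refine ⟨2 * M, fun z hz => ?_⟩
  have hz0 : |g z| ≤ M := hM z (by simpa using hz.trans (by linarith))
  rcases eq_or_ne (gradient g z) 0 with h0 | h0
  · rw [h0, norm_zero]
    linarith [abs_nonneg (g z)]
  -- A unit step against the gradient: concavity forces `g` to drop by at least `‖gradient g z‖`,
  -- while `|g| ≤ M` at both ends.
  set d : Eucl n := ‖gradient g z‖⁻¹ • gradient g z with hd'
  have hdn : ‖d‖ = 1 := by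
    rw [hd', norm_smul, norm_inv, norm_norm, inv_mul_cancel₀ (norm_ne_zero_iff.2 h0)]
  have hz1 : |g (z - d)| ≤ M := by
    apply hM
    simpa using (norm_sub_le z d).trans (by linarith)
  have h := hg.le_add_inner_gradient (hd z) (z - d)
  have e : inner ℝ (gradient g z) (z - d - z) = - ‖gradient g z‖ := by
    rw [sub_sub_cancel_left, inner_neg_right, hd', inner_smul_right, real_inner_self_eq_norm_sq]
    field_simp
  rw [e] at h
  linarith [abs_le.1 hz0, abs_le.1 hz1]

/-! ### Existence of Karush-Kuhn-Tucker multipliers. -/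

/-- A hyperplane separates the origin from the open convex set of pairs strictly dominating some `(f
x - c, -g x)`. This set is closed under increasing coordinates, so the normal has nonnegative
components; Slater's point excludes a vanishing `f`-component, and dividing by it gives the
multiplier. -/
theorem exists_lagrange_multiplier {E : Type*} {m : ℕ} [NormedAddCommGroup E]
    [NormedSpace ℝ E] {f : E → ℝ} {g : Fin m → E → ℝ} (hf : ConvexOn ℝ univ f)
    (hg : ∀ i, ConcaveOn ℝ univ (g i)) (hslater : ∃ z, ∀ i, 0 < g i z) {c : ℝ}
    (hc : ∀ x, (∀ i, 0 ≤ g i x) → c ≤ f x) :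
    ∃ lam : Fin m → ℝ, (∀ i, 0 ≤ lam i) ∧ ∀ x, c ≤ f x - ∑ i, lam i * g i x := by
  obtain ⟨z, hz⟩ := hslater
  let A : Set (ℝ × (Fin m → ℝ)) := {p | ∃ x, f x - c < p.1 ∧ ∀ i, -g i x < p.2 i}
  have hAo : IsOpen A := by
    have : A = ⋃ x, {p : ℝ × (Fin m → ℝ) | f x - c < p.1} ∩ ⋂ i, {p | -g i x < p.2 i} := by
      ext p; simp [A]
    rw [this]
    refine isOpen_iUnion fun x => IsOpen.inter ?_ (isOpen_iInter_of_finite fun i => ?_)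
    · exact isOpen_lt continuous_const continuous_fst
    · exact isOpen_lt continuous_const ((continuous_apply i).comp continuous_snd)
  have hAc : Convex ℝ A := by
    rw [convex_iff_forall_pos]
    rintro p ⟨x, hx1, hx2⟩ q ⟨y, hy1, hy2⟩ a b ha hb hab
    refine ⟨a • x + b • y, ?_, fun i => ?_⟩
    · have h := hf.2 (mem_univ x) (mem_univ y) ha.le hb.le hab
      simp only [smul_eq_mul, Prod.fst_add, Prod.smul_fst] at h ⊢
      have : c = a * c + b * c := by rw [← add_mul, hab, one_mul]
      nlinarith [mul_lt_mul_of_pos_left hx1 ha, mul_lt_mul_of_pos_left hy1 hb]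
    · have h := (hg i).2 (mem_univ x) (mem_univ y) ha.le hb.le hab
      simp only [smul_eq_mul, Prod.snd_add, Prod.smul_snd, Pi.add_apply, Pi.smul_apply] at h ⊢
      nlinarith [mul_lt_mul_of_pos_left (hx2 i) ha, mul_lt_mul_of_pos_left (hy2 i) hb]
  have hA0 : (0 : ℝ × (Fin m → ℝ)) ∉ A := by
    rintro ⟨x, hx1, hx2⟩
    have := hc x fun i => by have := hx2 i; simp at this; exact this.le
    simp at hx1
    linarith
  obtain ⟨φ, hφ⟩ := geometric_hahn_banach_open_point hAc hAo hA0
  simp only [map_zero] at hφ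
  set a : ℝ := -φ (1, 0) with ha
  set b : Fin m → ℝ := fun i => -φ (0, Pi.single i 1) with hb
  have hrep : ∀ r y, φ (r, y) = -(a * r + ∑ i, b i * y i) := by
    intro r y
    have h1 : ((r, y) : ℝ × (Fin m → ℝ)) = r • (1, 0) + ∑ i, y i • (0, Pi.single i 1) := by
      ext j
      · simp [Prod.fst_sum]
      · simp [Prod.snd_sum, Finset.sum_apply, Pi.single_apply]
    rw [h1, map_add, map_sum, map_smul]
    simp only [map_smul, smul_eq_mul, ha, hb]
    rw [neg_add, ← Finset.sum_neg_distrib]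
    congr 1
    · ring
    · exact Finset.sum_congr rfl fun i _ => by ring
  have hlag : ∀ x r, (∀ s : Fin m → ℝ, f x - c < r → (∀ i, 0 < s i) →
      0 < a * r + ∑ i, b i * (s i - g i x)) := by
    intro x r s hr hs
    have := hφ (r, fun i => s i - g i x) ⟨x, hr, fun i => by have := hs i; simp; linarith⟩
    rw [hrep] at this
    linarith
  have ha0 : 0 ≤ a := by
    by_contra! h
    -- If `a < 0`, a first coordinate of at least `S / (-a)` makes the separating expression
    -- nonpositive.
    set S := ∑ i, b i * (1 - g i z)
    have := hlag z (max (f z - c + 1) (S / (-a))) (fun _ => 1)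
      (lt_of_lt_of_le (by linarith) (le_max_left _ _)) (fun _ => one_pos)
    have h2 : S / (-a) ≤ max (f z - c + 1) (S / (-a)) := le_max_right _ _
    rw [div_le_iff₀ (by linarith)] at h2
    simp only [S] at h2
    nlinarith
  have hb0 : ∀ i, 0 ≤ b i := by
    intro i
    by_contra! h
    set S := a * (f z - c + 1) + ∑ j, b j * (1 - g j z)
    -- The extra slack in coordinate `i` contributes exactly `-|S|`, which outweighs `S`.
    have h1 := hlag z (f z - c + 1) (fun j => 1 + if j = i then |S| / (-b i) else 0)
      (by linarith) (fun j => by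
        split_ifs
        · have : 0 ≤ |S| / (-b i) := div_nonneg (abs_nonneg _) (by linarith)
          linarith
        · norm_num)
    have h2 : ∑ j, b j * (1 + (if j = i then |S| / (-b i) else 0) - g j z) =
        ∑ j, b j * (1 - g j z) - |S| := by
      have : ∀ j, b j * (1 + (if j = i then |S| / (-b i) else 0) - g j z) =
          b j * (1 - g j z) + if j = i then b j * (|S| / (-b i)) else 0 := by
        intro j; split_ifs <;> ring
      simp only [this, Finset.sum_add_distrib, Finset.sum_ite_eq', Finset.mem_univ, if_true]
      have : b i ≠ 0 := h.ne
      field_simp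
      ring
    rw [h2] at h1
    have := le_abs_self S
    simp only [S] at this h1
    linarith
  have hmin : ∀ x, 0 ≤ a * (f x - c) - ∑ i, b i * g i x := by
    intro x
    have ht : Filter.Tendsto
        (fun s : ℝ => a * (f x - c + s) + ∑ i, b i * (s - g i x)) (nhdsWithin 0 (Ioi 0))
        (nhds (a * (f x - c + 0) + ∑ i, b i * (0 - g i x))) := by
      apply Filter.Tendsto.mono_left _ nhdsWithin_le_nhds
      apply Continuous.tendsto (f := fun s : ℝ => a * (f x - c + s) + ∑ i, b i * (s - g i x))
      fun_prop
    have h := ge_of_tendsto (b := (0 : ℝ)) ht (by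
      filter_upwards [self_mem_nhdsWithin] with s hs
      have hs' : (0 : ℝ) < s := hs
      exact (hlag x (f x - c + s) (fun _ => s) (by linarith) (fun _ => hs')).le)
    simpa [sub_eq_add_neg] using h
  -- If `a = 0`, then `hmin` at the Slater point forces every `b i` to vanish, against the strict
  -- inequality `hlag`.
  have hapos : 0 < a := by
    refine lt_of_le_of_ne ha0 fun h0 => ?_
    have h1 := hmin z
    rw [← h0] at h1
    have h2 : ∑ i, b i * g i z = 0 := le_antisymm (by linarith)
      (Finset.sum_nonneg fun i _ => mul_nonneg (hb0 i) (hz i).le)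
    rw [Finset.sum_eq_zero_iff_of_nonneg
      (fun i _ => mul_nonneg (hb0 i) (hz i).le)] at h2
    have h3 := hlag z (f z - c + 1) (fun _ => 1) (by linarith) (fun _ => one_pos)
    rw [← h0] at h3
    have h4 : ∀ i, b i = 0 := fun i =>
      (mul_eq_zero.1 (h2 i (Finset.mem_univ i))).resolve_right (hz i).ne'
    simp [h4] at h3
  refine ⟨fun i => b i / a, fun i => div_nonneg (hb0 i) hapos.le, fun x => ?_⟩
  have h := hmin x
  have e : ∑ i, b i / a * g i x = (∑ i, b i * g i x) / a := by
    rw [Finset.sum_div]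
    exact Finset.sum_congr rfl fun i _ => by ring
  rw [e]
  have : (∑ i, b i * g i x) / a ≤ f x - c := by
    rw [div_le_iff₀ hapos]; linarith
  linarith

/-- With `c = f xs`, the Lagrangian inequality at `xs` itself yields complementarity; the Lagrangian
is then globally minimal at `xs`, which yields stationarity. -/
theorem SlaterCondition.exists_satisfiesKKT {n m : ℕ} {f : Eucl n → ℝ} {g : Fin m → Eucl n → ℝ}
    (hslater : SlaterCondition g) (hfd : Differentiable ℝ f) (hf : ConvexOn ℝ univ f)
    (hgd : ∀ i, Differentiable ℝ (g i)) (hg : ∀ i, ConcaveOn ℝ univ (g i)) {xs : Eucl n}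
    (hxs : IsConstrainedMinimizer f g xs) :
    ∃ lam : Fin m → ℝ, SatisfiesKKT f g xs lam := by
  obtain ⟨lam, hl0, hl⟩ := exists_lagrange_multiplier hf hg hslater (c := f xs)
    fun x hx => hxs.2 hx
  have hnn : ∀ i, 0 ≤ lam i * g i xs := fun i => mul_nonneg (hl0 i) (hxs.1 i)
  have hsum : ∑ i, lam i * g i xs = 0 :=
    le_antisymm (by linarith [hl xs]) (Finset.sum_nonneg fun i _ => hnn i)
  refine ⟨lam, hxs.1, hl0, fun i => ?_, ?_⟩
  · exact (Finset.sum_eq_zero_iff_of_nonneg fun i _ => hnn i).1 hsum i (Finset.mem_univ i)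
  · have hmin : IsLocalMin (fun x => f x - ∑ i, lam i * g i x) xs :=
      Filter.Eventually.of_forall fun x => by
        simpa only [hsum, sub_zero] using hl x
    have hder : HasFDerivAt (fun x => f x - ∑ i, lam i * g i x)
        (fderiv ℝ f xs - ∑ i, lam i • fderiv ℝ (g i) xs) xs :=
      (hfd xs).hasFDerivAt.sub
        (HasFDerivAt.fun_sum fun i _ => ((hgd i xs).hasFDerivAt.const_mul (lam i)))
    have h0 := hmin.hasFDerivAt_eq_zero hder
    apply ext_inner_right ℝ
    intro v
    have hv := congrArg (fun L => L v) h0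
    simp only [sub_apply, sum_apply, smul_apply, zero_apply, smul_eq_mul] at hv
    simp only [sum_inner, real_inner_smul_left, inner_gradient_left]
    linarith

/-! ### The pointwise energy inequality. -/

theorem StrongConvexOn.inner_gradient_sub_le {E : Type*} [NormedAddCommGroup E]
    [InnerProductSpace ℝ E] [CompleteSpace E] {f : E → ℝ} {μ : ℝ} (hf : StrongConvexOn univ μ f)
    (hd : Differentiable ℝ f) (x y : E) :
    μ * ‖x - y‖ ^ 2 ≤ inner ℝ (gradient f x - gradient f y) (x - y) := by
  have h1 := hf.add_inner_gradient_add_le (hd x) y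
  have h2 := hf.add_inner_gradient_add_le (hd y) x
  rw [norm_sub_rev, ← neg_sub x y, inner_neg_right] at h1
  rw [inner_sub_left]
  linarith

/-- The modulus of strong convexity is at most the Lipschitz constant of the gradient. -/
theorem OneSmooth.modulus_le_one {n : ℕ} [Nontrivial (Eucl n)] {f : Eucl n → ℝ} {μ : ℝ}
    (hs : OneSmooth f) (hf : StrongConvexOn univ μ f) : μ ≤ 1 := by
  obtain ⟨x, y, hxy⟩ := exists_pair_ne (Eucl n)
  have h1 := hf.inner_gradient_sub_le hs.1 x y
  have h2 := real_inner_le_norm (gradient f x - gradient f y) (x - y)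
  have h3 := hs.2.norm_sub_le x y
  have h4 : 0 < ‖x - y‖ := norm_pos_iff.2 (sub_ne_zero.2 hxy)
  simp only [NNReal.coe_one, one_mul] at h3
  have : μ * ‖x - y‖ ^ 2 ≤ 1 * ‖x - y‖ ^ 2 := by nlinarith
  exact le_of_mul_le_mul_right this (by positivity)

/-- The decay of the energy `½|α(x - xs) + u|² + f(x) - f(xs)` along the unconstrained dynamics,
at the level of points. -/
theorem StrongConvexOn.energy_decay {E : Type*} [NormedAddCommGroup E]
    [InnerProductSpace ℝ E] [CompleteSpace E] {f : E → ℝ} {μ : ℝ} (hf : StrongConvexOn univ μ f)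
    (hd : Differentiable ℝ f) {a a' d b : ℝ} (ha : 0 ≤ a) (hb : 0 ≤ b) (hab : a * b ≤ 1)
    (h₁ : a' + a ^ 2 / 2 ≤ μ / 2) (h₂ : 2 * a ^ 2 + a' = 2 * a * d + a * μ * b)
    (h₃ : 3 / 2 * a ≤ 2 * d + μ * b) (xs x u : E) :
    inner ℝ (a' • (x - xs) + a • u - ((2 * d) • u + gradient f (x + b • u))) (a • (x - xs) + u)
      + inner ℝ (gradient f x) u + a / 2 * ‖a • (x - xs) + u‖ ^ 2 + a * (f x - f xs) ≤ 0 := by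
  set y := x + b • u with hy
  set e := x - xs with he
  -- The gap `f x - f xs` is split at the extrapolated point `y`, where the dynamics evaluate the
  -- gradient.
  have i1 := hf.add_inner_gradient_add_le (hd y) xs
  have i2 := hf.add_inner_gradient_add_le (hd x) y
  have e1 : xs - y = -(e + b • u) := by rw [hy, he]; abel
  have e2 : y - x = b • u := by rw [hy]; abel
  have i3 : inner ℝ (gradient f x - gradient f y) u ≤ -(μ * b * ‖u‖ ^ 2) := by
    rcases hb.eq_or_lt with h0 | h0
    · simp [hy, ← h0]
    · have h := hf.inner_gradient_sub_le hd y x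
      rw [e2, norm_smul, inner_smul_right, Real.norm_of_nonneg hb, mul_pow,
        ← neg_sub (gradient f x), inner_neg_left] at h
      have : b * (μ * b * ‖u‖ ^ 2) ≤ b * -inner ℝ (gradient f x - gradient f y) u := by linarith
      linarith [le_of_mul_le_mul_left this h0]
  rw [e1, norm_neg, inner_neg_right, norm_add_sq_real, inner_add_right, norm_smul, mul_pow,
    inner_smul_right, inner_smul_right, Real.norm_of_nonneg hb] at i1
  rw [e2, norm_smul, inner_smul_right, Real.norm_of_nonneg hb, mul_pow] at i2
  rw [inner_sub_left] at i3
  simp only [norm_add_sq_real, inner_add_right, inner_sub_left, inner_add_left,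
    real_inner_smul_left, inner_smul_right, norm_smul, mul_pow, real_inner_self_eq_norm_sq,
    Real.norm_of_nonneg ha, real_inner_comm e u]
  set eu := inner ℝ e u
  set cu := inner ℝ (gradient f y) u
  set ce := inner ℝ (gradient f y) e
  set du := inner ℝ (gradient f x) u
  -- After `j1` the gradient terms collapse to `(1 - a * b) * (du - cu)`, which `j2` bounds by
  -- strong monotonicity. In the remaining quadratic form the `b ^ 2` terms cancel; `h₁`, `h₂`, `h₃`
  -- settle the coefficients of `‖e‖ ^ 2`, `eu` and `‖u‖ ^ 2`.
  have j1 := mul_le_mul_of_nonneg_left (add_le_add i1 i2) ha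
  have j2 := mul_le_mul_of_nonneg_left i3 (sub_nonneg.2 hab)
  have j3 := mul_le_mul_of_nonneg_right (mul_le_mul_of_nonneg_left h₁ ha) (sq_nonneg ‖e‖)
  have j4 := mul_le_mul_of_nonneg_right h₃ (sq_nonneg ‖u‖)
  have j5 : (2 * a ^ 2 + a') * eu = (2 * a * d + a * μ * b) * eu := by rw [h₂]
  nlinarith

/-! ### The product rule for distribution functions of measures with atoms. -/

section ProductRule

variable {E F G : Type*} [NormedAddCommGroup E] [NormedSpace ℝ E]
  [NormedAddCommGroup F] [NormedSpace ℝ F] [NormedAddCommGroup G] [NormedSpace ℝ G]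

/-- `p` is the distribution function on `[0, ∞)`, starting from `p₀`, of the vector measure with
density `P` with respect to `m`. -/
def HasDensityOn (m : Measure ℝ) (p₀ : E) (p P : ℝ → E) : Prop :=
  ∀ t, 0 ≤ t → IntegrableOn P (Icc 0 t) m ∧ p t = p₀ + ∫ s in Icc 0 t, P s ∂m

theorem HasDensityOn.add {m : Measure ℝ} {p₀ q₀ : E} {p P q Q : ℝ → E}
    (hp : HasDensityOn m p₀ p P) (hq : HasDensityOn m q₀ q Q) :
    HasDensityOn m (p₀ + q₀) (fun t => p t + q t) (fun t => P t + Q t) := fun t ht => by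
  obtain ⟨h1, h2⟩ := hp t ht
  obtain ⟨h3, h4⟩ := hq t ht
  refine ⟨h1.add h3, ?_⟩
  simp only [integral_add h1 h3, h2, h4]
  abel

theorem HasDensityOn.const_smul {m : Measure ℝ} {p₀ : E} {p P : ℝ → E}
    (hp : HasDensityOn m p₀ p P) (c : ℝ) :
    HasDensityOn m (c • p₀) (fun t => c • p t) (fun t => c • P t) := fun t ht => by
  obtain ⟨h1, h2⟩ := hp t ht
  refine ⟨h1.smul c, ?_⟩
  simp only [integral_smul, h2, smul_add]

variable [CompleteSpace E] [CompleteSpace F] [CompleteSpace G]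

/-- Fubini on the two halves of the plane. The diagonal, charged by atoms, must be counted once; it
goes with the closed half, hence `Iic` in one term and `Iio` in the other. -/
theorem integral_bilin_integral_eq {μ : Measure ℝ} [SFinite μ] {P : ℝ → E} {Q : ℝ → F}
    (hP : Integrable P μ) (hQ : Integrable Q μ) (B : E →L[ℝ] F →L[ℝ] G) :
    Integrable (fun s => B (P s) (∫ r in Iic s, Q r ∂μ)) μ ∧
    Integrable (fun s => B (∫ r in Iio s, P r ∂μ) (Q s)) μ ∧
    B (∫ s, P s ∂μ) (∫ s, Q s ∂μ) =
      ∫ s, B (P s) (∫ r in Iic s, Q r ∂μ) ∂μ + ∫ s, B (∫ r in Iio s, P r ∂μ) (Q s) ∂μ := by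
  have hint : Integrable (fun z : ℝ × ℝ => B (P z.1) (Q z.2)) (μ.prod μ) :=
    hP.op_fst_snd (by fun_prop) ⟨‖B‖, B.le_opNorm₂⟩ hQ
  have hm1 : MeasurableSet {z : ℝ × ℝ | z.2 ≤ z.1} := measurableSet_le measurable_snd measurable_fst
  have hm2 : MeasurableSet {z : ℝ × ℝ | z.1 < z.2} := measurableSet_lt measurable_fst measurable_snd
  have hi1 := hint.indicator hm1
  have hi2 := hint.indicator hm2
  have e1 : (fun s => ∫ r, ({z : ℝ × ℝ | z.2 ≤ z.1}.indicator
      (fun z : ℝ × ℝ => B (P z.1) (Q z.2))) (s, r) ∂μ)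
      = fun s => B (P s) (∫ r in Iic s, Q r ∂μ) := by
    funext s
    rw [← ContinuousLinearMap.integral_comp_comm _ hQ.integrableOn,
      ← integral_indicator measurableSet_Iic]
    rfl
  have e2 : (fun s => ∫ r, ({z : ℝ × ℝ | z.1 < z.2}.indicator
      (fun z : ℝ × ℝ => B (P z.1) (Q z.2))) (r, s) ∂μ)
      = fun s => B (∫ r in Iio s, P r ∂μ) (Q s) := by
    funext s
    have := ContinuousLinearMap.integral_comp_comm (B.flip (Q s))
      (hP.integrableOn (s := Iio s))
    simp only [ContinuousLinearMap.flip_apply] at this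
    rw [← this, ← integral_indicator measurableSet_Iio]
    rfl
  refine ⟨?_, ?_, ?_⟩
  · rw [← e1]; exact hi1.integral_prod_left
  · rw [← e2]; exact hi2.integral_prod_right
  · rw [← integral_prod_bilin B, ← e1, ← e2, ← integral_prod _ hi1, ← integral_prod_symm _ hi2,
      ← integral_add hi1 hi2]
    · congr 1
      funext z
      by_cases h : z.2 ≤ z.1
      · simp [indicator, h, not_lt.2 h]
      · simp [indicator, h, not_le.1 h]
    all_goals assumption

/-- The Leibniz rule `d B(p, q) = B(dp, q) + B(p⁻, dq)`: subtracting the atom `m.real {s} • P s`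
turns the right-continuous value of `p` into its left limit. -/
theorem HasDensityOn.bilin {m : Measure ℝ} [SFinite m] {p₀ : E} {q₀ : F} {p P : ℝ → E}
    {q Q : ℝ → F} (hp : HasDensityOn m p₀ p P) (hq : HasDensityOn m q₀ q Q)
    (B : E →L[ℝ] F →L[ℝ] G) :
    HasDensityOn m (B p₀ q₀) (fun t => B (p t) (q t))
      (fun s => B (P s) (q s) + B (p s - m.real {s} • P s) (Q s)) := by
  intro t ht
  obtain ⟨hP, hpt⟩ := hp t ht
  obtain ⟨hQ, hqt⟩ := hq t ht
  obtain ⟨h1, h2, h3⟩ := integral_bilin_integral_eq hP hQ B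
  set μ := m.restrict (Icc 0 t)
  have hq' : ∀ s ∈ Icc 0 t, q s = q₀ + ∫ r in Iic s, Q r ∂μ := by
    intro s hs
    rw [(hq s hs.1).2, Measure.restrict_restrict measurableSet_Iic]
    congr 3
    ext r; simp only [mem_inter_iff, mem_Iic, mem_Icc]
    exact ⟨fun h => ⟨h.2, h.1, h.2.trans hs.2⟩, fun h => ⟨h.2.1, h.1⟩⟩
  have hp' : ∀ s ∈ Icc 0 t, p s - m.real {s} • P s = p₀ + ∫ r in Iio s, P r ∂μ := by
    intro s hs
    have e : Icc 0 s = (Iio s ∩ Icc 0 t) ∪ {s} := by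
      ext r; simp only [mem_inter_iff, mem_Iio, mem_Icc, mem_union, mem_singleton_iff]
      constructor
      · rintro ⟨h0, h1⟩
        rcases h1.eq_or_lt with h | h
        · exact Or.inr h
        · exact Or.inl ⟨h, h0, h.le.trans hs.2⟩
      · rintro (h | rfl)
        · exact ⟨h.2.1, h.1.le⟩
        · exact ⟨hs.1, le_rfl⟩
    rw [(hp s hs.1).2, Measure.restrict_restrict measurableSet_Iio, e, setIntegral_union,
      integral_singleton]
    · abel
    · simp
    · exact measurableSet_singleton s
    · exact hP.mono_set inter_subset_right
    · exact hP.mono_set (singleton_subset_iff.2 hs)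
  have hae : (fun s => B (P s) (q s) + B (p s - m.real {s} • P s) (Q s)) =ᵐ[μ]
      fun s => (B (P s) q₀ + B (P s) (∫ r in Iic s, Q r ∂μ)) +
        (B p₀ (Q s) + B (∫ r in Iio s, P r ∂μ) (Q s)) := by
    filter_upwards [ae_restrict_mem measurableSet_Icc] with s hs
    rw [hq' s hs, hp' s hs, map_add, map_add]
    rfl
  have i1 : Integrable (fun s => B (P s) q₀) μ := (B.flip q₀).integrable_comp hP
  have i2 : Integrable (fun s => B p₀ (Q s)) μ := (B p₀).integrable_comp hQ
  refine ⟨((i1.add h1).add (i2.add h2)).congr hae.symm, ?_⟩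
  have e1 : ∫ s, B (P s) q₀ ∂μ = B (∫ s, P s ∂μ) q₀ := (B.flip q₀).integral_comp_comm hP
  have e2 : ∫ s, B p₀ (Q s) ∂μ = B p₀ (∫ s, Q s ∂μ) := (B p₀).integral_comp_comm hQ
  have e3 := integral_add (i1.add h1) (i2.add h2)
  simp only [Pi.add_apply] at e3
  rw [integral_congr_ae hae, e3, integral_add i1 h1, integral_add i2 h2, e1, e2]
  simp only [hpt, hqt, map_add, add_apply, h3]
  abel

/-- If the density is nonpositive then the distribution function is bounded by its initial
value. -/
theorem HasDensityOn.le_of_ae_nonpos {m : Measure ℝ} {p₀ : ℝ} {p P : ℝ → ℝ}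
    (hp : HasDensityOn m p₀ p P) (h : ∀ᵐ s ∂m, P s ≤ 0) {t : ℝ} (ht : 0 ≤ t) : p t ≤ p₀ := by
  rw [(hp t ht).2]
  have : ∫ s in Icc 0 t, P s ∂m ≤ 0 := integral_nonpos_of_ae (ae_restrict_of_ae h)
  linarith

end ProductRule

/-! ### Velocities of bounded variation and the time measure. -/

/-- The variation function from `0`, extended by a constant to negative times, dominates the
increments of `u`. Countability of discontinuities and local bounds thus pass from monotone
functions to vector-valued `u`. -/
theorem LocallyBoundedVariationOn.exists_monotone_dist_le {E : Type*} [PseudoMetricSpace E]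
    {u : ℝ → E} (hu : LocallyBoundedVariationOn u (Ici 0)) :
    ∃ φ : ℝ → ℝ, Monotone φ ∧ ∀ s t, 0 ≤ s → 0 ≤ t → dist (u s) (u t) ≤ |φ s - φ t| := by
  have hmono := variationOnFromTo.monotoneOn hu (a := 0) self_mem_Ici
  refine ⟨fun t => variationOnFromTo u (Ici 0) 0 (max t 0), fun s t hst =>
    hmono (mem_Ici.2 (le_max_right _ _)) (mem_Ici.2 (le_max_right _ _)) (max_le_max_right _ hst), ?_⟩
  have key : ∀ s t, 0 ≤ s → s ≤ t → dist (u t) (u s) ≤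
      variationOnFromTo u (Ici 0) 0 t - variationOnFromTo u (Ici 0) 0 s := by
    intro s t hs hst
    rw [variationOnFromTo.sub_right hu self_mem_Ici (mem_Ici.2 (hs.trans hst)) (mem_Ici.2 hs),
      variationOnFromTo.eq_of_le _ _ hst]
    exact (hu s t hs (hs.trans hst)).dist_le ⟨hs.trans hst, hst, le_rfl⟩ ⟨hs, le_rfl, hst⟩
  intro s t hs ht
  simp only [max_eq_left hs, max_eq_left ht]
  rcases le_total s t with h | h
  · rw [dist_comm, abs_sub_comm]
    exact (key s t hs h).trans (le_abs_self _)
  · exact (key t s ht h).trans (le_abs_self _)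

section BoundedVariation

variable {n : ℕ} {u : ℝ → Eucl n}

theorem LocallyBoundedVariationOn.countable_not_continuousAt
    (hu : LocallyBoundedVariationOn u (Ici 0)) : {t | 0 < t ∧ ¬ContinuousAt u t}.Countable := by
  obtain ⟨φ, hφ, hd⟩ := hu.exists_monotone_dist_le
  refine hφ.countable_not_continuousAt.mono fun t ht => ?_
  refine mt (fun hc : ContinuousAt φ t => ?_) ht.2
  rw [ContinuousAt, tendsto_iff_dist_tendsto_zero]
  have h1 : Filter.Tendsto (fun s => |φ s - φ t|) (nhds t) (nhds 0) := by
    have := (hc.tendsto.sub_const (φ t)).abs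
    simpa using this
  refine squeeze_zero' (Filter.Eventually.of_forall fun _ => dist_nonneg) ?_ h1
  filter_upwards [Ioi_mem_nhds ht.1] with s hs
  exact hd s t (le_of_lt hs) ht.1.le

theorem LocallyBoundedVariationOn.ae_continuousAt (hu : LocallyBoundedVariationOn u (Ici 0)) :
    ∀ᵐ t ∂(volume.restrict (Ici (0 : ℝ))), 0 < t ∧ ContinuousAt u t := by
  rw [ae_restrict_iff' measurableSet_Ici]
  filter_upwards [hu.countable_not_continuousAt.ae_notMem volume,
    (countable_singleton (0 : ℝ)).ae_notMem volume] with t h1 h2 h3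
  have ht : 0 < t := lt_of_le_of_ne h3 fun h => h2 h.symm
  exact ⟨ht, by_contra fun h => h1 ⟨ht, h⟩⟩

theorem LocallyBoundedVariationOn.tendsto_limPlus (hu : LocallyBoundedVariationOn u (Ici 0))
    {t : ℝ} (ht : 0 ≤ t) : Filter.Tendsto u (nhdsWithin t (Ioi t)) (nhds (limPlus u t)) := by
  apply tendsto_rightLim_of_tendsto
  obtain ⟨l, hl⟩ := (hu 0 (t + 1) self_mem_Ici (mem_Ici.2 (by linarith))).exists_tendsto_right t
  refine ⟨l, ?_⟩
  rwa [nhdsWithin_inter_of_mem] at hl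
  filter_upwards [Ioo_mem_nhdsGT (lt_add_one t)] with s hs
  have := ht.trans hs.1.le
  exact ⟨this, this, hs.2.le⟩

theorem limPlus_eq_of_continuousAt {t : ℝ} (h : ContinuousAt u t) : limPlus u t = u t :=
  h.continuousWithinAt.rightLim_eq

theorem limMinus_eq_of_continuousAt {t : ℝ} (ht : 0 < t) (h : ContinuousAt u t) :
    limMinus u t = u t := by
  rw [limMinus, if_neg (not_le.2 ht)]
  exact h.continuousWithinAt.leftLim_eq

theorem notMem_jumpTimes_of_continuousAt {t : ℝ} (ht : 0 < t) (h : ContinuousAt u t) :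
    t ∉ jumpTimes u := fun hj =>
  hj.2 (by rw [limPlus_eq_of_continuousAt h, limMinus_eq_of_continuousAt ht h])

theorem LocallyBoundedVariationOn.countable_jumpTimes
    (hu : LocallyBoundedVariationOn u (Ici 0)) : (jumpTimes u).Countable := by
  refine (hu.countable_not_continuousAt.union (countable_singleton 0)).mono fun t ht => ?_
  rcases ht.1.eq_or_lt with h | h
  · exact Or.inr h.symm
  · exact Or.inl ⟨h, fun hc => notMem_jumpTimes_of_continuousAt h hc ht⟩

theorem LocallyBoundedVariationOn.exists_norm_le (hu : LocallyBoundedVariationOn u (Ici 0))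
    (T : ℝ) : ∃ C, ∀ t ∈ Icc 0 T, ‖u t‖ ≤ C := by
  obtain ⟨φ, hφ, hd⟩ := hu.exists_monotone_dist_le
  refine ⟨|φ T - φ 0| + ‖u 0‖, fun t ht => ?_⟩
  have h1 := hd t 0 ht.1 le_rfl
  have h2 : |φ t - φ 0| ≤ |φ T - φ 0| := by
    rw [abs_of_nonneg (sub_nonneg.2 (hφ ht.1)), abs_of_nonneg (sub_nonneg.2 (hφ (ht.1.trans ht.2)))]
    linarith [hφ ht.2]
  have h3 : ‖u t‖ ≤ dist (u t) (u 0) + ‖u 0‖ := by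
    rw [dist_eq_norm]
    simpa using norm_add_le (u t - u 0) (u 0)
  linarith

theorem LocallyBoundedVariationOn.aestronglyMeasurable
    (hu : LocallyBoundedVariationOn u (Ici 0)) (T : ℝ) :
    AEStronglyMeasurable u (volume.restrict (Icc 0 T)) := by
  -- Nothing is known of `u` at negative times, so its constant extension is used.
  have h : Measurable fun t => u (max t 0) := by
    apply measurable_of_countable_not_continuousAt
    refine (hu.countable_not_continuousAt.union (countable_singleton 0)).mono fun t ht => ?_
    rcases lt_trichotomy t 0 with h | h | h
    · refine absurd ?_ ht
      refine continuousAt_const.congr (f := fun _ => u 0) ?_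
      filter_upwards [Iio_mem_nhds h] with s hs
      rw [max_eq_right (le_of_lt hs)]
    · exact Or.inr h
    · refine Or.inl ⟨h, fun hc => ht (hc.congr ?_)⟩
      filter_upwards [Ioi_mem_nhds h] with s hs
      rw [max_eq_left (le_of_lt hs)]
  refine h.aestronglyMeasurable.congr ?_
  filter_upwards [ae_restrict_mem measurableSet_Icc] with t ht
  rw [max_eq_left ht.1]

theorem LocallyBoundedVariationOn.ae_limPlus_eq (hu : LocallyBoundedVariationOn u (Ici 0))
    (T : ℝ) : limPlus u =ᵐ[volume.restrict (Icc 0 T)] u := by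
  filter_upwards [ae_mono (Measure.restrict_mono Icc_subset_Ici_self le_rfl) hu.ae_continuousAt]
    with t ht
  exact limPlus_eq_of_continuousAt ht.2

theorem LocallyBoundedVariationOn.integrableOn (hu : LocallyBoundedVariationOn u (Ici 0))
    (T : ℝ) : IntegrableOn u (Icc 0 T) volume := by
  obtain ⟨C, hC⟩ := hu.exists_norm_le T
  exact Integrable.of_bound (hu.aestronglyMeasurable T) C
    (by filter_upwards [ae_restrict_mem measurableSet_Icc] with t ht using hC t ht)

/-- Needed for Fubini in the product rule; it holds because the jump times are countable, so the
atomic part is a countable sum of finite measures. -/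
theorem LocallyBoundedVariationOn.sFinite_timeMeasure
    (hu : LocallyBoundedVariationOn u (Ici 0)) : SFinite (timeMeasure u) := by
  have : SFinite (Measure.count.restrict (jumpTimes u) : Measure ℝ) := by
    have hc := hu.countable_jumpTimes.to_subtype
    have h := Measure.restrict_biUnion (μ := (Measure.count : Measure ℝ)) (s := fun t : ℝ => {t})
      (T := jumpTimes u) hc (fun s _ t _ hst => by simpa [Function.onFun] using hst)
      fun t => measurableSet_singleton t
    rw [biUnion_of_singleton] at h
    rw [h]
    have : ∀ t : jumpTimes u, SFinite ((Measure.count : Measure ℝ).restrict {(t : ℝ)}) := by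
      intro t
      have : IsFiniteMeasure ((Measure.count : Measure ℝ).restrict {(t : ℝ)}) :=
        ⟨by simp⟩
      infer_instance
    infer_instance
  unfold timeMeasure
  infer_instance

theorem timeMeasure_real_singleton_of_mem {t : ℝ} (ht : t ∈ jumpTimes u) :
    (timeMeasure u).real {t} = 1 := by
  have : (timeMeasure u) {t} = 1 := by
    rw [timeMeasure, Measure.add_apply, Measure.restrict_apply (measurableSet_singleton t),
      Measure.restrict_apply (measurableSet_singleton t), inter_eq_left.2 (singleton_subset_iff.2 ht),
      Measure.count_singleton, measure_mono_null inter_subset_left (by simp), zero_add]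
  rw [measureReal_def, this, ENNReal.toReal_one]

theorem timeMeasure_real_singleton_of_notMem {t : ℝ} (ht : t ∉ jumpTimes u) :
    (timeMeasure u).real {t} = 0 := by
  have : (timeMeasure u) {t} = 0 := by
    rw [timeMeasure, Measure.add_apply, Measure.restrict_apply (measurableSet_singleton t),
      Measure.restrict_apply (measurableSet_singleton t), singleton_inter_eq_empty.2 ht,
      measure_mono_null inter_subset_left (by simp), zero_add, measure_empty]
  rw [measureReal_def, this, ENNReal.toReal_zero]

theorem ae_timeMeasure_iff (hu : LocallyBoundedVariationOn u (Ici 0)) {p : ℝ → Prop} :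
    (∀ᵐ t ∂timeMeasure u, p t) ↔
      (∀ᵐ t ∂(volume.restrict (Ici (0 : ℝ))), p t) ∧ ∀ t ∈ jumpTimes u, p t := by
  rw [timeMeasure, ae_add_measure_iff]
  refine and_congr_right fun _ => ?_
  rw [ae_restrict_iff' hu.countable_jumpTimes.measurableSet]
  simp [ae_iff, Measure.count_eq_zero_iff, eq_empty_iff_forall_notMem]

/-- An absolutely continuous function is a distribution function with respect to the time
measure. -/
theorem LocallyBoundedVariationOn.hasDensityOn_of_integral
    (hu : LocallyBoundedVariationOn u (Ici 0)) {E : Type*} [NormedAddCommGroup E]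
    [NormedSpace ℝ E] {p P : ℝ → E} (hP : ∀ t, 0 ≤ t → IntegrableOn P (Icc 0 t) volume)
    (hp : ∀ t, 0 ≤ t → p t = p 0 + ∫ s in Icc 0 t, P s) :
    HasDensityOn (timeMeasure u) (p 0) p ((jumpTimes u)ᶜ.indicator P) := by
  have hJ := hu.countable_jumpTimes.measurableSet
  -- The jump times are Lebesgue null, so cutting them out of the time measure leaves exactly
  -- Lebesgue measure.
  have hres : ∀ t, ((timeMeasure u).restrict (Icc 0 t)).restrict (jumpTimes u)ᶜ =
      volume.restrict (Icc 0 t) := by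
    intro t
    rw [Measure.restrict_restrict hJ.compl, timeMeasure, Measure.restrict_add,
      Measure.restrict_restrict (hJ.compl.inter measurableSet_Icc),
      Measure.restrict_restrict (hJ.compl.inter measurableSet_Icc)]
    have e1 : (jumpTimes u)ᶜ ∩ Icc 0 t ∩ jumpTimes u = ∅ := by
      ext s; simp; tauto
    have e2 : (jumpTimes u)ᶜ ∩ Icc 0 t ∩ Ici 0 = Icc 0 t \ jumpTimes u := by
      ext s; simp; tauto
    rw [e1, e2, Measure.restrict_empty, add_zero]
    exact Measure.restrict_congr_set (sdiff_null_ae_eq_self (hu.countable_jumpTimes.measure_zero _))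
  intro t ht
  constructor
  · rw [IntegrableOn, integrable_indicator_iff hJ.compl, IntegrableOn, hres]
    exact hP t ht
  · rw [integral_indicator hJ.compl, hres]
    exact hp t ht

end BoundedVariation

/-! ### Calculus along the position. -/

section Position

variable {n : ℕ} {x u : ℝ → Eucl n}

theorem continuousOn_position (hu : LocallyBoundedVariationOn u (Ici 0))
    (hx : ∀ t, 0 ≤ t → x t = x 0 + ∫ s in (0 : ℝ)..t, u s) : ContinuousOn x (Ici 0) := by
  intro t ht
  have ht' : (0 : ℝ) ≤ t + 1 := by linarith [mem_Ici.1 ht]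
  have h1 : ContinuousOn (fun t => x 0 + ∫ s in (0 : ℝ)..t, u s) (Icc 0 (t + 1)) := by
    have := intervalIntegral.continuousOn_primitive_interval (μ := volume) (a := 0) (b := t + 1)
      (by rw [uIcc_of_le ht']; exact hu.integrableOn (t + 1))
    rw [uIcc_of_le ht'] at this
    exact continuousOn_const.add this
  have h2 : ContinuousOn x (Icc 0 (t + 1)) := h1.congr fun s hs => hx s hs.1
  refine (h2 t ⟨ht, by linarith⟩).mono_of_mem_nhdsWithin ?_
  filter_upwards [self_mem_nhdsWithin, mem_nhdsWithin_of_mem_nhds (Iio_mem_nhds (lt_add_one t))]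
    with s h1 h2 using ⟨h1, le_of_lt h2⟩

/-- Right limits of `u` exist everywhere, so the right derivative exists at every time, jumps
included. This is what the fundamental theorem for right derivatives requires. -/
theorem hasDerivWithinAt_position (hu : LocallyBoundedVariationOn u (Ici 0))
    (hx : ∀ t, 0 ≤ t → x t = x 0 + ∫ s in (0 : ℝ)..t, u s) {t : ℝ} (ht : 0 ≤ t) :
    HasDerivWithinAt x (limPlus u t) (Ici t) t := by
  have hi : IntervalIntegrable u volume 0 t :=
    (intervalIntegrable_iff_integrableOn_Icc_of_le ht).2 (hu.integrableOn t)
  have hm : StronglyMeasurableAtFilter u (nhdsWithin t (Ioi t)) volume := by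
    refine ⟨Icc 0 (t + 1), ?_, hu.aestronglyMeasurable _⟩
    filter_upwards [Ioo_mem_nhdsGT (lt_add_one t)] with s hs using ⟨ht.trans hs.1.le, hs.2.le⟩
  have h := intervalIntegral.integral_hasDerivWithinAt_of_tendsto_ae_right (s := Ici t) hi hm
    ((hu.tendsto_limPlus ht).mono_left inf_le_left)
  exact (h.const_add (x 0)).congr (fun s hs => hx s (ht.trans hs)) (hx t ht)

theorem hasDerivWithinAt_comp_position (hu : LocallyBoundedVariationOn u (Ici 0))
    (hx : ∀ t, 0 ≤ t → x t = x 0 + ∫ s in (0 : ℝ)..t, u s) {h : Eucl n → ℝ}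
    (hd : Differentiable ℝ h) {t : ℝ} (ht : 0 ≤ t) :
    HasDerivWithinAt (fun t => h (x t)) (inner ℝ (gradient h (x t)) (limPlus u t)) (Ici t) t := by
  rw [inner_gradient_left]
  exact (hd (x t)).hasFDerivAt.comp_hasDerivWithinAt t (hasDerivWithinAt_position hu hx ht)

theorem aestronglyMeasurable_comp_position (hxc : ContinuousOn x (Ici 0)) {G : Eucl n → Eucl n}
    (hG : Measurable G) (ν : Measure ℝ) (T : ℝ) :
    AEStronglyMeasurable (fun s => G (x s)) (ν.restrict (Icc 0 T)) :=
  (hG.comp_aemeasurable ((hxc.mono Icc_subset_Ici_self).aemeasurable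
    measurableSet_Icc)).aestronglyMeasurable

theorem exists_norm_comp_position_le (hxc : ContinuousOn x (Ici 0)) {G : Eucl n → Eucl n}
    (hGb : ∀ R, ∃ C, ∀ z, ‖z‖ ≤ R → ‖G z‖ ≤ C) (T : ℝ) :
    ∃ C, ∀ s ∈ Icc 0 T, ‖G (x s)‖ ≤ C := by
  obtain ⟨R, hR⟩ := (isCompact_Icc (a := 0) (b := T)).exists_bound_of_continuousOn
    (hxc.mono Icc_subset_Ici_self)
  obtain ⟨C, hC⟩ := hGb R
  exact ⟨C, fun s hs => hC _ (hR s hs)⟩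

/-- Measurability and local boundedness of `G` suffice, so this applies to constraint gradients
without proving them continuous. -/
theorem integrableOn_inner_limPlus (hu : LocallyBoundedVariationOn u (Ici 0))
    (hxc : ContinuousOn x (Ici 0)) {G : Eucl n → Eucl n}
    (hG : Measurable G) (hGb : ∀ R, ∃ C, ∀ z, ‖z‖ ≤ R → ‖G z‖ ≤ C) (T : ℝ) :
    IntegrableOn (fun s => inner ℝ (G (x s)) (limPlus u s)) (Icc 0 T) volume := by
  obtain ⟨C, hC⟩ := exists_norm_comp_position_le hxc hGb T
  have hw : IntegrableOn (limPlus u) (Icc 0 T) volume :=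
    (hu.integrableOn T).congr (hu.ae_limPlus_eq T).symm
  refine (hw.norm.const_mul C).mono'
    ((aestronglyMeasurable_comp_position hxc hG _ T).inner hw.aestronglyMeasurable) ?_
  filter_upwards [ae_restrict_mem measurableSet_Icc] with s hs
  exact (norm_inner_le_norm _ _).trans
    (mul_le_mul_of_nonneg_right (hC s hs) (norm_nonneg _))

theorem measurable_gradient (h : Eucl n → ℝ) : Measurable (gradient h) :=
  (InnerProductSpace.toDual ℝ (Eucl n)).symm.continuous.measurable.comp (measurable_fderiv ℝ h)

end Position

/-- The fundamental theorem of calculus on `[0, ∞)` for right derivatives. -/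
theorem eq_add_integral_of_hasDerivWithinAt_Ici {E : Type*} [NormedAddCommGroup E]
    [NormedSpace ℝ E] [CompleteSpace E] {p P : ℝ → E} (hp : ContinuousOn p (Ici 0))
    (hd : ∀ t, 0 ≤ t → HasDerivWithinAt p (P t) (Ici t) t)
    (hP : ∀ t, 0 ≤ t → IntegrableOn P (Icc 0 t) volume) {t : ℝ} (ht : 0 ≤ t) :
    p t = p 0 + ∫ s in Icc 0 t, P s := by
  have h := intervalIntegral.integral_eq_sub_of_hasDeriv_right_of_le ht
    (hp.mono Icc_subset_Ici_self) (fun s hs => (hd s hs.1.le).mono Ioi_subset_Ici_self)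
    ((intervalIntegrable_iff_integrableOn_Icc_of_le ht).2 (hP t ht))
  rw [intervalIntegral.integral_of_le ht, ← integral_Icc_eq_integral_Ioc] at h
  rw [h]
  abel

/-! ### Decay schedules and the decay of constraint violations. -/

/-- Parameter schedules for which the momentum dynamics decay with rate `ρ`. -/
structure IsDecaySchedule (μ : ℝ) (α α' δ β ρ : ℝ → ℝ) : Prop where
  alpha_nonneg : ∀ t, 0 ≤ t → 0 ≤ α t
  beta_nonneg : ∀ t, 0 ≤ t → 0 ≤ β t
  alpha_mul_beta_le_one : ∀ t, 0 ≤ t → α t * β t ≤ 1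
  hasDerivAt_alpha : ∀ t, 0 ≤ t → HasDerivAt α (α' t) t
  continuousOn_alpha' : ContinuousOn α' (Ici 0)
  continuousOn_delta : ContinuousOn δ (Ici 0)
  continuousOn_beta : ContinuousOn β (Ici 0)
  rho_pos : ∀ t, 0 ≤ t → 0 < ρ t
  rho_zero : ρ 0 = 1
  hasDerivAt_rho : ∀ t, 0 ≤ t → HasDerivAt ρ (-(α t * ρ t)) t
  -- The last three conditions are the coefficient hypotheses `h₁`, `h₂`, `h₃` of
  -- `StrongConvexOn.energy_decay`.
  position_coeff : ∀ t, 0 ≤ t → α' t + α t ^ 2 / 2 ≤ μ / 2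
  cross_coeff : ∀ t, 0 ≤ t → 2 * α t ^ 2 + α' t = 2 * α t * δ t + α t * μ * β t
  velocity_coeff : ∀ t, 0 ≤ t → 3 / 2 * α t ≤ 2 * δ t + μ * β t

namespace IsDecaySchedule

variable {μ : ℝ} {α α' δ β ρ : ℝ → ℝ}

theorem hasDerivAt_inv_rho (hs : IsDecaySchedule μ α α' δ β ρ) {t : ℝ} (ht : 0 ≤ t) :
    HasDerivAt (fun t => (ρ t)⁻¹) (α t * (ρ t)⁻¹) t := by
  have h := (hs.hasDerivAt_rho t ht).fun_inv (hs.rho_pos t ht).ne'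
  have e : -(-(α t * ρ t)) / ρ t ^ 2 = α t * (ρ t)⁻¹ := by
    have := (hs.rho_pos t ht).ne'
    field_simp
  rwa [e] at h

theorem continuousOn_alpha (hs : IsDecaySchedule μ α α' δ β ρ) : ContinuousOn α (Ici 0) :=
  fun t ht => (hs.hasDerivAt_alpha t ht).continuousAt.continuousWithinAt

theorem continuousOn_inv_rho (hs : IsDecaySchedule μ α α' δ β ρ) :
    ContinuousOn (fun t => (ρ t)⁻¹) (Ici 0) :=
  fun _ ht => (hs.hasDerivAt_inv_rho ht).continuousAt.continuousWithinAt

end IsDecaySchedule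

/-- A constraint whose velocity is nonnegative whenever it is violated has violation decaying with
rate `ρ`. -/
theorem IsDecaySchedule.min_mul_rho_le {n : ℕ} {μ : ℝ} {α α' δ β ρ : ℝ → ℝ} {x u : ℝ → Eucl n}
    (hs : IsDecaySchedule μ α α' δ β ρ) (hu : LocallyBoundedVariationOn u (Ici 0))
    (hx : ∀ t, 0 ≤ t → x t = x 0 + ∫ s in (0 : ℝ)..t, u s) {g : Eucl n → ℝ}
    (hgd : Differentiable ℝ g) (hg : ConcaveOn ℝ univ g)
    (hv : ∀ᵐ t ∂(volume.restrict (Ici (0 : ℝ))), g (x t) ≤ 0 →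
      0 ≤ constraintVelocity g (α t) (x t) (limPlus u t)) {t : ℝ} (ht : 0 ≤ t) :
    min 0 (g (x 0)) * ρ t ≤ g (x t) := by
  have hxc := continuousOn_position hu hx
  set h : ℝ → ℝ := fun s => (ρ s)⁻¹ * g (x s) with hh
  -- Since `ρ' = -αρ`, the right derivative of `g(x) / ρ` is the constraint velocity divided by `ρ`.
  set h' : ℝ → ℝ := fun s => α s * (ρ s)⁻¹ * g (x s) +
    (ρ s)⁻¹ * inner ℝ (gradient g (x s)) (limPlus u s) with hh'
  have hgx : ContinuousOn (fun s => g (x s)) (Ici 0) := hgd.continuous.comp_continuousOn hxc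
  have hc : ContinuousOn h (Ici 0) := hs.continuousOn_inv_rho.mul hgx
  have hder : ∀ s, 0 ≤ s → HasDerivWithinAt h (h' s) (Ici s) s := fun s h0 =>
    (hs.hasDerivAt_inv_rho h0).hasDerivWithinAt.mul (hasDerivWithinAt_comp_position hu hx hgd h0)
  have hint : ∀ T, IntegrableOn h' (Icc 0 T) volume := fun T => by
    refine Integrable.add ?_ ?_
    · exact (((hs.continuousOn_alpha.mul hs.continuousOn_inv_rho).mul hgx).mono
        Icc_subset_Ici_self).integrableOn_Icc
    · exact (integrableOn_inner_limPlus hu hxc (measurable_gradient g)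
        (hg.exists_norm_gradient_le hgd) T).continuousOn_mul
          (hs.continuousOn_inv_rho.mono Icc_subset_Ici_self) isCompact_Icc
  have h0 : h 0 = g (x 0) := by simp [hh, hs.rho_zero]
  suffices hmain : min 0 (h 0) ≤ h t by
    rw [h0, hh] at hmain
    have := mul_le_mul_of_nonneg_right hmain (hs.rho_pos t ht).le
    have hne := (hs.rho_pos t ht).ne'
    dsimp only at this
    rwa [mul_comm (ρ t)⁻¹, mul_assoc, inv_mul_cancel₀ hne, mul_one] at this
  by_contra! hlt
  set c := min 0 (h 0) with hcdef
  have hcpt : IsCompact {s ∈ Icc 0 t | c ≤ h s} :=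
    isCompact_Icc.of_isClosed_subset
      ((hc.mono Icc_subset_Ici_self).preimage_isClosed_of_isClosed isClosed_Icc isClosed_Ici)
      fun s hs => hs.1
  -- The last time `r` at which `h` is at least `c`. After it the constraint is violated, so `h`
  -- cannot decrease on `[r, t]`, contradicting `h t < c`.
  obtain ⟨r, ⟨⟨hr0, hrt⟩, hrc⟩, hrmax⟩ := hcpt.exists_isGreatest
    ⟨0, ⟨le_rfl, ht⟩, min_le_right _ _⟩
  have hsub : Icc r t ⊆ Icc 0 t := Icc_subset_Icc_left hr0
  have hftc := intervalIntegral.integral_eq_sub_of_hasDeriv_right_of_le hrt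
    (hc.mono (hsub.trans Icc_subset_Ici_self))
    (fun s hs => (hder s (hr0.trans hs.1.le)).mono Ioi_subset_Ici_self)
    ((intervalIntegrable_iff_integrableOn_Icc_of_le hrt).2 ((hint t).mono_set hsub))
  have hpos : 0 ≤ ∫ s in r..t, h' s := by
    apply intervalIntegral.integral_nonneg_of_ae_restrict hrt
    have hv' := ae_mono (Measure.restrict_mono (hsub.trans Icc_subset_Ici_self) le_rfl) hv
    filter_upwards [hv', ae_restrict_mem measurableSet_Icc,
      ae_restrict_of_ae ((countable_singleton r).ae_notMem volume)] with s h1 h2 h3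
    have hs0 := hr0.trans h2.1
    have hκ : 0 < (ρ s)⁻¹ := inv_pos.2 (hs.rho_pos s hs0)
    have hneg : g (x s) ≤ 0 := by
      by_contra! hp
      have : s ≤ r := hrmax ⟨⟨hs0, h2.2⟩, (min_le_left _ _).trans (mul_pos hκ hp).le⟩
      exact h3 (le_antisymm this h2.1)
    have := mul_nonneg hκ.le (h1 hneg)
    rw [constraintVelocity] at this
    simp only [hh', Pi.zero_apply]
    linarith
  linarith

/-! ### The contact force. -/

section ContactForce

/-- The normal cone of a half-line encodes complementarity: the test point `0` gives `l * w ≤ 0`,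
and `-l - 1` gives `0 ≤ w`. -/
theorem nonneg_and_mul_eq_zero_of_mem_normalConeReal {w l : ℝ}
    (h : w ∈ normalConeReal (Iic 0) (-l)) : 0 ≤ l ∧ 0 ≤ w ∧ l * w = 0 := by
  obtain ⟨h1, h2⟩ := h
  have hl : 0 ≤ l := by simpa using h1
  have h3 := h2 0 (by simp)
  have h4 := h2 (-l - 1) (by simp; linarith)
  have hw : 0 ≤ w := by linarith
  exact ⟨hl, hw, le_antisymm (by linarith) (mul_nonneg hl hw)⟩

variable {n m : ℕ} {g : Fin m → Eucl n → ℝ}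

/-- The contact force dissipates energy at contacts with restitution, both between jumps and at
jumps. -/
theorem inner_constraintForce_nonpos (hgd : ∀ i, Differentiable ℝ (g i))
    (hg : ∀ i, ConcaveOn ℝ univ (g i)) {xs : Eucl n} (hxs : xs ∈ feasibleSet g) {a ε : ℝ}
    (ha : 0 ≤ a) (hε0 : 0 ≤ ε) (hε1 : ε < 1) {x v w : Eucl n} {l : Fin m → ℝ}
    (hcomp : ∀ i, g i x ≤ 0 → constraintVelocity (g i) a x v + ε * constraintVelocity (g i) a x w
      ∈ normalConeReal (Iic 0) (-(l i)))
    (hjump : 0 ≤ inner ℝ (constraintForce g x l) (v - w)) :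
    inner ℝ (constraintForce g x l) ((2 * a) • (x - xs) + v + w) ≤ 0 := by
  classical
  set I := Finset.univ.filter fun i => g i x ≤ 0 with hI
  have hinner : ∀ y, inner ℝ (constraintForce g x l) y =
      ∑ i ∈ I, l i * inner ℝ (gradient (g i) x) y := by
    intro y
    rw [constraintForce, sum_inner]
    refine Finset.sum_congr (by ext; simp [hI]) fun i _ => real_inner_smul_left _ _ _
  have hc : ∀ i ∈ I, 0 ≤ l i ∧ l i * (constraintVelocity (g i) a x v +
      ε * constraintVelocity (g i) a x w) = 0 := fun i hi => by
    have := nonneg_and_mul_eq_zero_of_mem_normalConeReal (hcomp i (by simpa [hI] using hi))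
    exact ⟨this.1, this.2.2⟩
  -- `A` and `B` are the force-weighted velocities after and before. Complementarity gives `A = -ε *
  -- B`, and `A - B ≥ 0` then forces `B ≤ 0`; hence `A + B = (1 - ε) * B ≤ 0`.
  set A := ∑ i ∈ I, l i * constraintVelocity (g i) a x v
  set B := ∑ i ∈ I, l i * constraintVelocity (g i) a x w
  have h1 : A + ε * B = 0 := by
    rw [Finset.mul_sum, ← Finset.sum_add_distrib]
    refine Finset.sum_eq_zero fun i hi => ?_
    rw [← (hc i hi).2]
    ring
  have h2 : 0 ≤ A - B := by
    rw [hinner] at hjump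
    rw [← Finset.sum_sub_distrib]
    refine hjump.trans_eq (Finset.sum_congr rfl fun i _ => ?_)
    simp only [constraintVelocity, inner_sub_right]
    ring
  have h3 : inner ℝ (constraintForce g x l) ((2 * a) • (x - xs) + v + w) ≤ A + B := by
    rw [hinner, ← Finset.sum_add_distrib]
    refine Finset.sum_le_sum fun i hi => ?_
    -- Concavity and feasibility of `xs` give `⟨∇gᵢ(x), x - xs⟩ ≤ gᵢ(x)`; the factor `2 * a` matches
    -- the two terms `a * gᵢ(x)` in the velocities.
    have hconc := (hg i).le_add_inner_gradient (hgd i x) xs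
    have hfeas := hxs i
    have e : xs - x = -(x - xs) := by abel
    rw [e, inner_neg_right] at hconc
    rw [← mul_add]
    refine mul_le_mul_of_nonneg_left ?_ (hc i hi).1
    simp only [constraintVelocity, inner_add_right, inner_smul_right]
    have := mul_le_mul_of_nonneg_left
      (show inner ℝ (gradient (g i) x) (x - xs) ≤ g i x by linarith) ha
    linarith
  have hB : B ≤ 0 := by nlinarith
  nlinarith

theorem integrableOn_constraintForce (hgd : ∀ i, Differentiable ℝ (g i))
    (hg : ∀ i, ConcaveOn ℝ univ (g i)) {x : ℝ → Eucl n} (hxc : ContinuousOn x (Ici 0))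
    {l : Fin m → ℝ → ℝ} {ν : Measure ℝ} {T : ℝ} (hl : ∀ i, IntegrableOn (l i) (Icc 0 T) ν) :
    IntegrableOn (fun s => constraintForce g (x s) (fun i => l i s)) (Icc 0 T) ν := by
  classical
  -- Cutting off the gradients replaces the time-dependent active set by a sum over all indices.
  let G : Fin m → Eucl n → Eucl n := fun i z => if g i z ≤ 0 then gradient (g i) z else 0
  have hG : ∀ i, Measurable (G i) := fun i =>
    Measurable.ite (measurableSet_le (hgd i).continuous.measurable measurable_const)
      (measurable_gradient (g i)) measurable_const
  have hGb : ∀ i R, ∃ C, ∀ z, ‖z‖ ≤ R → ‖G i z‖ ≤ C := fun i R => by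
    obtain ⟨C, hC⟩ := (hg i).exists_norm_gradient_le (hgd i) R
    refine ⟨C, fun z hz => ?_⟩
    simp only [G]
    split_ifs
    · exact hC z hz
    · exact norm_zero.trans_le ((norm_nonneg _).trans (hC z hz))
  have e : (fun s => constraintForce g (x s) (fun i => l i s)) =
      fun s => ∑ i, l i s • G i (x s) := by
    funext s
    rw [constraintForce, Finset.sum_filter]
    refine Finset.sum_congr rfl fun i _ => ?_
    simp only [G]
    split_ifs <;> simp
  rw [e]
  refine integrable_finsetSum _ fun i _ => ?_
  obtain ⟨C, hC⟩ := exists_norm_comp_position_le hxc (hGb i) T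
  refine ((hl i).norm.const_mul C).mono'
    ((hl i).aestronglyMeasurable.smul (aestronglyMeasurable_comp_position hxc (hG i) ν T)) ?_
  filter_upwards [ae_restrict_mem measurableSet_Icc] with s hs
  rw [norm_smul, mul_comm]
  exact mul_le_mul_of_nonneg_right (hC s hs) (norm_nonneg _)

end ContactForce

/-! ### Energy along trajectories. -/

/-- The velocity after jumps as a distribution function with respect to the time measure: the
integrated form of the measure-differential inclusion. -/
theorem hasDensityOn_limPlus {n : ℕ} {u : ℝ → Eucl n} {H F : ℝ → Eucl n}
    (hu : LocallyBoundedVariationOn u (Ici 0))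
    (hH : ∀ T, 0 ≤ T → IntegrableOn H (Icc 0 T) volume)
    (hF : ∀ T, 0 ≤ T → IntegrableOn F (Icc 0 T) (timeMeasure u))
    (heq : ∀ t, 0 ≤ t → limPlus u t - u 0 + ∫ s in Icc 0 t, H s =
      ∫ s in Icc 0 t, F s ∂(timeMeasure u)) :
    HasDensityOn (timeMeasure u) (u 0) (limPlus u)
      (fun s => F s - (jumpTimes u)ᶜ.indicator H s) := by
  have hI := hu.hasDensityOn_of_integral (p := fun t => ∫ s in Icc 0 t, H s) hH (by simp)
  intro t ht
  obtain ⟨h1, h2⟩ := hI t ht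
  refine ⟨(hF t ht).sub h1, ?_⟩
  rw [integral_sub (hF t ht) h1, ← heq t ht]
  simp only [Icc_self, Measure.restrict_singleton, Real.volume_singleton, zero_smul,
    integral_zero_measure, zero_add] at h2
  rw [← h2]
  abel

theorem IsDecaySchedule.integrableOn_drift {n : ℕ} {μ : ℝ} {α α' δ β ρ : ℝ → ℝ}
    {x u : ℝ → Eucl n} (hs : IsDecaySchedule μ α α' δ β ρ)
    (hu : LocallyBoundedVariationOn u (Ici 0)) (hxc : ContinuousOn x (Ici 0))
    {G : Eucl n → Eucl n} (hG : Continuous G) (T : ℝ) :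
    IntegrableOn (fun s => (2 * δ s) • u s + G (x s + β s • u s)) (Icc 0 T) volume := by
  have hsub : Icc 0 T ⊆ Ici 0 := Icc_subset_Ici_self
  have h1 : IntegrableOn (fun s => (2 * δ s) • u s) (Icc 0 T) volume :=
    (hu.integrableOn T).continuousOn_smul
      (continuousOn_const.mul (hs.continuousOn_delta.mono hsub)) isCompact_Icc
  have h2 : AEStronglyMeasurable (fun s => x s + β s • u s) (volume.restrict (Icc 0 T)) :=
    ((hxc.mono hsub).aestronglyMeasurable measurableSet_Icc).add
      (((hs.continuousOn_beta.mono hsub).aestronglyMeasurable measurableSet_Icc).smul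
        (hu.aestronglyMeasurable T))
  obtain ⟨X, hX⟩ := isCompact_Icc.exists_bound_of_continuousOn (hxc.mono hsub)
  obtain ⟨b, hb⟩ := isCompact_Icc.exists_bound_of_continuousOn (hs.continuousOn_beta.mono hsub)
  obtain ⟨U, hU⟩ := hu.exists_norm_le T
  obtain ⟨C, hC⟩ := (isCompact_closedBall (0 : Eucl n) (X + b * U)).exists_bound_of_continuousOn
    hG.continuousOn
  refine h1.add (Integrable.of_bound (hG.comp_aestronglyMeasurable h2) C ?_)
  filter_upwards [ae_restrict_mem measurableSet_Icc] with s hs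
  apply hC
  rw [mem_closedBall_zero_iff]
  refine (norm_add_le _ _).trans (add_le_add (hX s hs) ?_)
  rw [norm_smul]
  exact mul_le_mul (hb s hs) (hU s hs) (norm_nonneg _) ((norm_nonneg _).trans (hb s hs))

/-- The decay of the energy along trajectories of the measure-differential inclusion. -/
theorem IsDecaySchedule.energy_le {n m : ℕ} {μ : ℝ} {α α' δ β ρ : ℝ → ℝ} {f : Eucl n → ℝ}
    {g : Fin m → Eucl n → ℝ} (hs : IsDecaySchedule μ α α' δ β ρ) (hf : OneSmooth f)
    (hconv : StrongConvexOn univ μ f) (hgd : ∀ i, Differentiable ℝ (g i))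
    (hg : ∀ i, ConcaveOn ℝ univ (g i)) {xs : Eucl n} (hxs : xs ∈ feasibleSet g) {ε : ℝ}
    (hε0 : 0 ≤ ε) (hε1 : ε < 1) {x u : ℝ → Eucl n} (htraj : IsMDITrajectory f g α δ β ε x u)
    {t : ℝ} (ht : 0 ≤ t) :
    (ρ t)⁻¹ * (1 / 2 * ‖α t • (x t - xs) + limPlus u t‖ ^ 2 + (f (x t) - f xs)) ≤
      1 / 2 * ‖α 0 • (x 0 - xs) + u 0‖ ^ 2 + (f (x 0) - f xs) := by
  obtain ⟨hu, hx, l, hl, heq, hcomp⟩ := htraj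
  have hxc := continuousOn_position hu hx
  have := hu.sFinite_timeMeasure
  have hgradc : Continuous (gradient f) := hf.2.continuous
  set F : ℝ → Eucl n := fun s => constraintForce g (x s) (fun i => l i s) with hFdef
  set H : ℝ → Eucl n := fun s => (2 * δ s) • u s + gradient f (x s + β s • u s) with hHdef
  set w : ℝ → Eucl n := limPlus u with hw
  have hwint : ∀ T, IntegrableOn w (Icc 0 T) volume := fun T =>
    (hu.integrableOn T).congr (hu.ae_limPlus_eq T).symm
  -- the distribution functions that make up the energy
  have d1 : HasDensityOn (timeMeasure u) (u 0) w (fun s => F s - (jumpTimes u)ᶜ.indicator H s) := by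
    refine hasDensityOn_limPlus hu (fun T _ => hs.integrableOn_drift hu hxc hgradc T)
      (fun T _ => integrableOn_constraintForce hgd hg hxc fun i => hl i T) fun t ht => ?_
    have := heq 0 t le_rfl ht
    rwa [limMinus, if_pos le_rfl] at this
  have d2 : HasDensityOn (timeMeasure u) (α 0 • (x 0 - xs)) (fun t => α t • (x t - xs))
      ((jumpTimes u)ᶜ.indicator fun s => α s • w s + α' s • (x s - xs)) := by
    have hP : ∀ t, 0 ≤ t →
        IntegrableOn (fun s => α s • w s + α' s • (x s - xs)) (Icc 0 t) volume := fun t _ =>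
      Integrable.add ((hwint t).continuousOn_smul
        (hs.continuousOn_alpha.mono Icc_subset_Ici_self) isCompact_Icc)
        ((hs.continuousOn_alpha'.smul (hxc.sub continuousOn_const)).mono
          Icc_subset_Ici_self).integrableOn_Icc
    refine hu.hasDensityOn_of_integral (p := fun t => α t • (x t - xs)) hP fun t ht => ?_
    exact eq_add_integral_of_hasDerivWithinAt_Ici (p := fun t => α t • (x t - xs))
      (hs.continuousOn_alpha.smul (hxc.sub continuousOn_const))
      (fun s h0 => (hs.hasDerivAt_alpha s h0).hasDerivWithinAt.smul
        ((hasDerivWithinAt_position hu hx h0).sub_const xs)) hP ht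
  have d3 : HasDensityOn (timeMeasure u) (ρ 0)⁻¹ (fun t => (ρ t)⁻¹)
      ((jumpTimes u)ᶜ.indicator fun s => α s * (ρ s)⁻¹) := by
    have hP : ∀ t, 0 ≤ t → IntegrableOn (fun s => α s * (ρ s)⁻¹) (Icc 0 t) volume := fun t _ =>
      ((hs.continuousOn_alpha.mul hs.continuousOn_inv_rho).mono
        Icc_subset_Ici_self).integrableOn_Icc
    refine hu.hasDensityOn_of_integral (p := fun t => (ρ t)⁻¹) hP fun t ht => ?_
    exact eq_add_integral_of_hasDerivWithinAt_Ici hs.continuousOn_inv_rho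
      (fun s h0 => (hs.hasDerivAt_inv_rho h0).hasDerivWithinAt) hP ht
  have hfx : ContinuousOn (fun s => f (x s) - f xs) (Ici 0) :=
    (hf.1.continuous.comp_continuousOn hxc).sub continuousOn_const
  have d4 : HasDensityOn (timeMeasure u) ((ρ 0)⁻¹ * (f (x 0) - f xs))
      (fun t => (ρ t)⁻¹ * (f (x t) - f xs))
      ((jumpTimes u)ᶜ.indicator fun s => α s * (ρ s)⁻¹ * (f (x s) - f xs) +
        (ρ s)⁻¹ * inner ℝ (gradient f (x s)) (w s)) := by
    have hP : ∀ t, 0 ≤ t → IntegrableOn (fun s => α s * (ρ s)⁻¹ * (f (x s) - f xs) +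
        (ρ s)⁻¹ * inner ℝ (gradient f (x s)) (w s)) (Icc 0 t) volume := fun t _ => by
      refine Integrable.add ?_ ?_
      · exact (((hs.continuousOn_alpha.mul hs.continuousOn_inv_rho).mul hfx).mono
          Icc_subset_Ici_self).integrableOn_Icc
      · refine (integrableOn_inner_limPlus hu hxc hgradc.measurable (fun R => ?_)
          t).continuousOn_mul (hs.continuousOn_inv_rho.mono Icc_subset_Ici_self) isCompact_Icc
        obtain ⟨C, hC⟩ := (isCompact_closedBall (0 : Eucl n) R).exists_bound_of_continuousOn
          hgradc.continuousOn
        exact ⟨C, fun z hz => hC z (mem_closedBall_zero_iff.2 hz)⟩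
    refine hu.hasDensityOn_of_integral (p := fun t => (ρ t)⁻¹ * (f (x t) - f xs)) hP
      fun t ht => ?_
    exact eq_add_integral_of_hasDerivWithinAt_Ici (p := fun t => (ρ t)⁻¹ * (f (x t) - f xs))
      (hs.continuousOn_inv_rho.mul hfx)
      (fun s h0 => (hs.hasDerivAt_inv_rho h0).hasDerivWithinAt.mul
        ((hasDerivWithinAt_comp_position hu hx hf.1 h0).sub_const (f xs))) hP ht
  let B : Eucl n →L[ℝ] Eucl n →L[ℝ] ℝ :=
    (innerₗ (Eucl n)).mkContinuous₂ 1 fun y z => by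
      simpa using norm_inner_le_norm (𝕜 := ℝ) y z
  have hB : ∀ y z, B y z = inner ℝ y z := fun _ _ => rfl
  have dv := d2.add d1
  -- The initial value involves `u 0`, not its right limit: a jump at time `0` is an atom of the
  -- measure and is treated like any other jump.
  have dE := (d3.bilin ((dv.bilin dv B).const_smul (1 / 2)) (ContinuousLinearMap.mul ℝ ℝ)).add d4
  have hle := dE.le_of_ae_nonpos ((ae_timeMeasure_iff hu).2 ⟨?_, ?_⟩) ht
  · simp only [ContinuousLinearMap.mul_apply', hB, real_inner_self_eq_norm_sq, smul_eq_mul,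
      hs.rho_zero, inv_one, one_mul] at hle
    rw [mul_add]
    exact hle
  -- At a continuity time there is no atom, and the density is the classical derivative: smooth
  -- dynamics plus contact force.
  · filter_upwards [((ae_timeMeasure_iff hu).1 hcomp).1, hu.ae_continuousAt,
      ae_restrict_mem measurableSet_Ici] with s hc ⟨h0, hcont⟩ hs0
    have hJ := notMem_jumpTimes_of_continuousAt h0 hcont
    have hws : w s = u s := limPlus_eq_of_continuousAt hcont
    have hJ' : s ∈ (jumpTimes u)ᶜ := hJ
    have hc' := hc
    rw [hws, limMinus_eq_of_continuousAt h0 hcont] at hc'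
    have hnp := inner_constraintForce_nonpos (v := u s) (w := u s) hgd hg hxs
      (hs.alpha_nonneg s hs0) hε0 hε1 hc' (by simp)
    have hen := hconv.energy_decay hf.1 (hs.alpha_nonneg s hs0) (hs.beta_nonneg s hs0)
      (hs.alpha_mul_beta_le_one s hs0) (hs.position_coeff s hs0) (hs.cross_coeff s hs0)
      (hs.velocity_coeff s hs0) xs (x s) (u s)
    have hκ := inv_pos.2 (hs.rho_pos s hs0)
    simp only [indicator_of_mem hJ', timeMeasure_real_singleton_of_notMem hJ, zero_smul, sub_zero,
      hB, ContinuousLinearMap.mul_apply', smul_eq_mul, hws, hFdef, hHdef]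
    set v := α s • (x s - xs) + u s with hv
    set Fs := constraintForce g (x s) fun i => l i s
    have e1 : inner ℝ Fs ((2 * α s) • (x s - xs) + u s + u s) = 2 * inner ℝ Fs v := by
      rw [← inner_smul_right, hv]
      congr 1
      module
    rw [e1] at hnp
    set N := α' s • (x s - xs) + α s • u s -
      ((2 * δ s) • u s + gradient f (x s + β s • u s)) with hN
    have e2 : α s • u s + α' s • (x s - xs) +
        (Fs - ((2 * δ s) • u s + gradient f (x s + β s • u s))) = Fs + N := by
      rw [hN]
      abel
    clear_value v N
    rw [e2, real_inner_comm (Fs + N) v, inner_add_left, real_inner_self_eq_norm_sq]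
    linarith [mul_nonpos_of_nonneg_of_nonpos hκ.le hen,
      mul_nonpos_of_nonneg_of_nonpos hκ.le hnp]
  · intro s hJ
    have hJ' : s ∉ (jumpTimes u)ᶜ := fun h => h hJ
    have hs0 : 0 ≤ s := hJ.1
    have hc := ((ae_timeMeasure_iff hu).1 hcomp).2 s hJ
    -- The inclusion integrated over the single point `s`. It gives `⟨F, u⁺ - u⁻⟩ = |F|² ≥ 0`, the
    -- hypothesis of the contact lemma.
    have hjump : w s - limMinus u s = F s := by
      have := heq s s hs0 le_rfl
      rw [Icc_self, integral_singleton, integral_singleton,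
        timeMeasure_real_singleton_of_mem hJ, one_smul,
        measureReal_def, Real.volume_singleton, ENNReal.toReal_zero, zero_smul, add_zero] at this
      exact this
    have hnp := inner_constraintForce_nonpos hgd hg hxs (hs.alpha_nonneg s hs0) hε0 hε1 hc
      (by rw [hjump]; exact real_inner_self_nonneg)
    have hκ := inv_pos.2 (hs.rho_pos s hs0)
    simp only [indicator_of_notMem hJ', timeMeasure_real_singleton_of_mem hJ, one_smul, sub_zero,
      hB, ContinuousLinearMap.mul_apply', smul_eq_mul, zero_add, add_zero, zero_mul, mul_zero]
    -- The two Leibniz terms, with the values after and before the jump, add up to the pairing in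
    -- the contact lemma.
    have e1 : inner ℝ (F s) ((2 * α s) • (x s - xs) + w s + limMinus u s) =
        inner ℝ (F s) (α s • (x s - xs) + w s) +
          inner ℝ (α s • (x s - xs) + w s - F s) (F s) := by
      rw [real_inner_comm (F s) (α s • (x s - xs) + w s - F s), ← inner_add_right, ← hjump]
      congr 1
      module
    have hnp' : inner ℝ (F s) ((2 * α s) • (x s - xs) + w s + limMinus u s) ≤ 0 := hnp
    rw [e1] at hnp'
    nlinarith

/-! ### The three parameter choices. -/

namespace MomentumVariant

theorem isDecaySchedule_heavyBall {μ : ℝ} (hμ : 0 < μ) :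
    IsDecaySchedule μ (heavyBall.alpha μ) (fun _ => 0) (heavyBall.delta μ) (heavyBall.beta μ)
      (heavyBall.rho μ) := by
  have hsq := Real.sq_sqrt hμ.le
  have hpos := Real.sqrt_pos.2 hμ
  change IsDecaySchedule μ (fun _ => √μ) _ (fun _ => √μ) (fun _ => 0)
    (fun t => Real.exp (-(√μ * t)))
  constructor <;> try beta_reduce
  · exact fun _ _ => hpos.le
  · exact fun _ _ => le_rfl
  · intro _ _; simp
  · exact fun t _ => hasDerivAt_const t _
  · exact continuousOn_const
  · exact continuousOn_const
  · exact continuousOn_const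
  · exact fun _ _ => Real.exp_pos _
  · simp
  · intro t _
    have h := (((hasDerivAt_id t).const_mul √μ).fun_neg).exp
    simp only [id, mul_one] at h
    convert h using 1
    ring
  · intro _ _; linarith
  · intro _ _; ring
  · intro _ _; linarith

theorem isDecaySchedule_nesterovConstant {μ : ℝ} (hμ : 0 < μ) (hμ1 : μ ≤ 1) :
    IsDecaySchedule μ (nesterovConstant.alpha μ) (fun _ => 0) (nesterovConstant.delta μ)
      (nesterovConstant.beta μ) (nesterovConstant.rho μ) := by
  have hpos := Real.sqrt_pos.2 hμ
  have h1 : √μ ≤ 1 := Real.sqrt_le_one.2 hμ1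
  have hsq := Real.sq_sqrt hμ.le
  set s := √μ with hs
  have ha : 0 ≤ s - μ / 2 := by nlinarith
  have ha1 : s - μ / 2 ≤ 1 := by linarith
  have hb : 0 ≤ (1 - s) / (1 + s) := div_nonneg (by linarith) (by linarith)
  have hb1 : (1 - s) / (1 + s) ≤ 1 := (div_le_one (by linarith)).2 (by linarith)
  -- The identity `2α = 2δ + μβ` yields both the cross and the velocity condition.
  have hkey : 2 * (s - μ / 2) = 2 * (s / (1 + s)) + μ * ((1 - s) / (1 + s)) := by
    have : 1 + s ≠ 0 := by linarith
    rw [← hsq]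
    field_simp
    ring
  change IsDecaySchedule μ (fun _ => s - μ / 2) _ (fun _ => s / (1 + s))
    (fun _ => (1 - s) / (1 + s)) (fun t => Real.exp (-((s - μ / 2) * t)))
  constructor <;> try beta_reduce
  · exact fun _ _ => ha
  · exact fun _ _ => hb
  · exact fun _ _ => mul_le_one₀ ha1 hb hb1
  · exact fun t _ => hasDerivAt_const t _
  · exact continuousOn_const
  · exact continuousOn_const
  · exact continuousOn_const
  · exact fun _ _ => Real.exp_pos _
  · simp
  · intro t _
    have h := (((hasDerivAt_id t).const_mul (s - μ / 2)).fun_neg).exp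
    simp only [id, mul_one] at h
    convert h using 1
    ring
  · intro _ _; nlinarith
  · intro _ _
    linear_combination (s - μ / 2) * hkey
  · intro _ _; linarith

/-- With modulus `0`, all three coefficient conditions hold with equality. -/
theorem isDecaySchedule_nesterovVarying (μ : ℝ) :
    IsDecaySchedule 0 (nesterovVarying.alpha μ) (fun t => -2 / (t + 3) ^ 2)
      (nesterovVarying.delta μ) (nesterovVarying.beta μ) (nesterovVarying.rho μ) := by
  have h3 : ∀ t : ℝ, 0 ≤ t → t + 3 ≠ 0 := fun t ht => by linarith
  have hd : ∀ t : ℝ, HasDerivAt (fun t : ℝ => t + 3) 1 t := fun t => (hasDerivAt_id t).add_const 3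
  have hc : ContinuousOn (fun t : ℝ => t + 3) (Ici 0) := by fun_prop
  change IsDecaySchedule 0 (fun t => 2 / (t + 3)) _ (fun t => 3 / (2 * (t + 3)))
    (fun t => t / (t + 3)) (fun t => 9 / (t + 3) ^ 2)
  constructor <;> try beta_reduce
  · intro t ht; positivity
  · intro t ht; positivity
  · intro t ht
    rw [div_mul_div_comm, div_le_one (by positivity)]
    nlinarith
  · intro t ht
    simp_rw [div_eq_mul_inv (2 : ℝ)]
    refine (((hd t).fun_inv (h3 t ht)).const_mul 2).congr_deriv ?_
    ring
  · exact continuousOn_const.div (hc.pow 2) fun t ht => pow_ne_zero 2 (h3 t ht)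
  · exact continuousOn_const.div (continuousOn_const.mul hc) fun t ht =>
      mul_ne_zero two_ne_zero (h3 t ht)
  · exact continuousOn_id.div hc h3
  · intro t ht; positivity
  · norm_num
  · intro t ht
    have := h3 t ht
    simp_rw [div_eq_mul_inv (9 : ℝ)]
    refine ((((hd t).fun_pow 2).fun_inv (pow_ne_zero 2 this)).const_mul 9).congr_deriv ?_
    field_simp
    norm_num
    ring
  · intro t ht
    have := h3 t ht
    apply le_of_eq
    field_simp
    norm_num
  · intro t ht
    have := h3 t ht
    field_simp
    norm_num
  · intro t ht
    have := h3 t ht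
    apply le_of_eq
    field_simp
    norm_num

/-- All three choices of parameters are decay schedules, except in dimension zero, where the
modulus `μ` is not bounded. -/
theorem exists_isDecaySchedule {n : ℕ} [Nontrivial (Eucl n)] {f : Eucl n → ℝ} (hf : OneSmooth f)
    (variant : MomentumVariant) {μ : ℝ} (hconv : variant.Convexity μ f) :
    ∃ ν α', StrongConvexOn univ ν f ∧ IsDecaySchedule ν (variant.alpha μ) α'
      (variant.delta μ) (variant.beta μ) (variant.rho μ) := by
  cases variant with
  | heavyBall => exact ⟨μ, _, hconv.2, isDecaySchedule_heavyBall hconv.1⟩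
  | nesterovConstant =>
    exact ⟨μ, _, hconv.2, isDecaySchedule_nesterovConstant hconv.1 (hf.modulus_le_one hconv.2)⟩
  | nesterovVarying =>
    exact ⟨0, _, strongConvexOn_zero.2 hconv, isDecaySchedule_nesterovVarying μ⟩

theorem Convexity.convexOn {n : ℕ} {f : Eucl n → ℝ} {variant : MomentumVariant} {μ : ℝ}
    (hconv : variant.Convexity μ f) : ConvexOn ℝ univ f := by
  cases variant with
  | heavyBall => exact strongConvexOn_zero.1 (hconv.2.mono hconv.1.le)
  | nesterovConstant => exact strongConvexOn_zero.1 (hconv.2.mono hconv.1.le)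
  | nesterovVarying => exact hconv

theorem rho_nonneg (variant : MomentumVariant) (μ t : ℝ) : 0 ≤ variant.rho μ t := by
  cases variant <;> simp only [rho] <;> positivity

end MomentumVariant

/-! ### Weak duality and the two bounds. -/

/-- Weak duality at a Karush-Kuhn-Tucker point. -/
theorem SatisfiesKKT.sum_mul_le {n m : ℕ} {f : Eucl n → ℝ} {g : Fin m → Eucl n → ℝ}
    {xs : Eucl n} {lam : Fin m → ℝ} (h : SatisfiesKKT f g xs lam) (hfd : Differentiable ℝ f)
    (hf : ConvexOn ℝ univ f) (hgd : ∀ i, Differentiable ℝ (g i))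
    (hg : ∀ i, ConcaveOn ℝ univ (g i)) (x : Eucl n) :
    ∑ i, lam i * g i x ≤ f x - f xs := by
  have h1 := (strongConvexOn_zero.2 hf).add_inner_gradient_add_le (hfd xs) x
  rw [h.stationary, sum_inner] at h1
  have h2 : ∑ i, lam i * g i x ≤ ∑ i, inner ℝ (lam i • gradient (g i) xs) (x - xs) := by
    refine Finset.sum_le_sum fun i _ => ?_
    rw [real_inner_smul_left]
    have := mul_le_mul_of_nonneg_left ((hg i).le_add_inner_gradient (hgd i xs) x) (h.nonneg i)
    rw [mul_add, h.complementary i, zero_add] at this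
    exact this
  linarith

/-- Along a trajectory, the velocity of a violated constraint is nonnegative at almost every
time. -/
theorem IsMDITrajectory.ae_constraintVelocity_nonneg {n m : ℕ} {f : Eucl n → ℝ}
    {g : Fin m → Eucl n → ℝ} {α δ β : ℝ → ℝ} {ε : ℝ} {x u : ℝ → Eucl n}
    (h : IsMDITrajectory f g α δ β ε x u) (hε0 : 0 ≤ ε) (i : Fin m) :
    ∀ᵐ t ∂(volume.restrict (Ici (0 : ℝ))), g i (x t) ≤ 0 →
      0 ≤ constraintVelocity (g i) (α t) (x t) (limPlus u t) := by
  obtain ⟨hu, -, l, -, -, hcomp⟩ := h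
  filter_upwards [((ae_timeMeasure_iff hu).1 hcomp).1, hu.ae_continuousAt] with t hc ⟨h0, hcont⟩ hneg
  have := (nonneg_and_mul_eq_zero_of_mem_normalConeReal (hc i hneg)).2.1
  rw [limMinus_eq_of_continuousAt h0 hcont] at this
  rw [limPlus_eq_of_continuousAt hcont] at this ⊢
  -- At a continuity time both one-sided velocities agree, so the inclusion says that `(1 + ε)`
  -- times the velocity is nonnegative.
  nlinarith

theorem theorem3 {n m : ℕ} (f : Eucl n → ℝ) (g : Fin m → Eucl n → ℝ)
    (hf : OneSmooth f)
    (hg : ∀ i, Differentiable ℝ (g i)) (hgc : ∀ i, ConcaveOn ℝ univ (g i))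
    (hslater : SlaterCondition g)
    (variant : MomentumVariant) (μ : ℝ) (hconv : variant.Convexity μ f)
    (ε : ℝ) (hε0 : 0 ≤ ε) (hε1 : ε < 1)
    (xs : Eucl n) (hxs : IsConstrainedMinimizer f g xs)
    (x u : ℝ → Eucl n)
    (htraj : IsMDITrajectory f g (variant.alpha μ) (variant.delta μ) (variant.beta μ) ε x u)
    (hu0 : u 0 = 0) :
    (∃ lam : Fin m → ℝ, SatisfiesKKT f g xs lam) ∧
    ∀ lam : Fin m → ℝ, SatisfiesKKT f g xs lam → ∀ t : ℝ, 0 ≤ t →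
      (∑ i, min 0 (g i (x 0)) * lam i) * variant.rho μ t ≤ f (x t) - f xs ∧
      f (x t) - f xs ≤
        (variant.alpha μ 0 ^ 2 / 2 * ‖x 0 - xs‖ ^ 2 + (f (x 0) - f xs)) * variant.rho μ t := by
  refine ⟨hslater.exists_satisfiesKKT hf.1 hconv.convexOn hg hgc hxs, fun lam hlam t ht => ?_⟩
  -- In dimension zero `μ` may exceed `1`, but `f (x t) - f xs` vanishes and both bounds are
  -- immediate.
  rcases subsingleton_or_nontrivial (Eucl n) with hn | hn
  · rw [Subsingleton.elim (x t) xs, Subsingleton.elim (x 0) xs]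
    have hle : ∑ i, min 0 (g i xs) * lam i ≤ 0 := Finset.sum_nonpos fun i _ =>
      mul_nonpos_of_nonpos_of_nonneg (min_le_left _ _) (hlam.nonneg i)
    simpa using mul_nonpos_of_nonpos_of_nonneg hle (variant.rho_nonneg μ t)
  obtain ⟨ν, α', hν, hs⟩ := variant.exists_isDecaySchedule hf hconv
  have hρ := hs.rho_pos t ht
  constructor
  · refine le_trans ?_ (hlam.sum_mul_le hf.1 hconv.convexOn hg hgc (x t))
    rw [Finset.sum_mul]
    refine Finset.sum_le_sum fun i _ => ?_
    have := hs.min_mul_rho_le htraj.1 htraj.2.1 (hg i) (hgc i)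
      (htraj.ae_constraintVelocity_nonneg hε0 i) ht
    calc _ = lam i * (min 0 (g i (x 0)) * variant.rho μ t) := by ring
      _ ≤ _ := mul_le_mul_of_nonneg_left this (hlam.nonneg i)
  · have h := hs.energy_le hf hν hg hgc hxs.1 hε0 hε1 htraj ht
    rw [hu0, add_zero, inv_mul_le_iff₀ hρ, norm_smul, mul_pow, Real.norm_eq_abs, sq_abs] at h
    -- Dropping the quadratic part of the energy at time `t` leaves the bound on `f`.
    have := sq_nonneg ‖variant.alpha μ t • (x t - xs) + limPlus u t‖
    linarith
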